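/- Let $\Lambda$ be a left and right Noetherian ring (associative with $1$), let $\mathrm{mod}\,\Lambda$ and $\mathrm{mod}\,\Lambda^{op}$ be the categories of finitely generated left, respectively right, $\Lambda$-modules, and let $(\ )^*=\mathrm{Hom}(\ ,\Lambda)$. Let $k$ be a non-negative integer and assume that $\Lambda$ is $(k+1)$-Gorenstein, i.e. in the minimal injective resolution $0\to{}_\Lambda\Lambda\to I'_0\to I'_1\to\cdots$ of the left module $\Lambda$ one has $\mathrm{fd}_\Lambda I'_i\le i$ for $0\le i\le k$. Notation. $\mathrm{id}$, $\mathrm{pd}$ and $\mathrm{fd}$ are injective, projective and flat dimension. $\mathrm{Fin.dim}\,\Lambda$ is the supremum of the finite projective dimensions of left $\Lambda$-modules, and $\mathrm{fin.dim}\,\Lambda$ is the supremum of the finite projective dimensions of modules in $\mathrm{mod}\,\Lambda$. (The zero module is given dimension $-\infty$.) For $N\in\mathrm{mod}\,\Lambda^{op}$: * $N$ has reduced grade at least $m$ if $\mathrm{Ext}^j_{\Lambda^{op}}(N,\Lambda)=0$ for $1\le j<m$. * $N$ is torsionless (resp. reflexive) if the evaluation map $\sigma_N:N\to N^{**}$,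 $\sigma_N(x)(f)=f(x)$, is injective (resp. bijective). * Every $N$ is of $D$-class $0$, and $N$ is of $D$-class $1$ if it is torsionless. For $m\ge 2$, $N$ is of $D$-class $m$ if it is torsionless and there are $T\in\mathrm{mod}\,\Lambda^{op}$ of $D$-class $m-1$, a module $Y\in\mathrm{mod}\,\Lambda$ with $Y^*$ projective, an epimorphism $\rho:Y\to T^*$, and an exact sequence $0\to T^{**}\xrightarrow{\rho^*}Y^*\to N\to 0$. Then: (A) If $\mathrm{fin.dim}\,\Lambda=k$, then $\mathrm{id}_\Lambda\Lambda=k$. (B) The following statements are equivalent: 1. $\mathrm{id}_\Lambda\Lambda\le k$. 2. $\mathrm{Fin.dim}\,\Lambda\le k$. 3. $\mathrm{fin.dim}\,\Lambda\le k$. 4. Each module in $\mathrm{mod}\,\Lambda^{op}$ with reduced grade at least $k+1$ is reflexive. 5. Each module in $\mathrm{mod}\,\Lambda^{op}$ with reduced grade at least $k+1$ is torsionless. 6. Each module in $\mathrm{mod}\,\Lambda^{op}$ of $D$-class $k$ is reflexive. 7. Each module $N\in\mathrm{mod}\,\Lambda^{op}$ of $D$-class $k$ for which $N^*$ is projective is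 itself projective. -/

import Mathlib

open CategoryTheory TensorProduct

universe u

/-! Left `R`-modules are `Module R`; right `R`-modules are `Module Rᵐᵒᵖ`, the action of `r` on the
right being `MulOpposite.op r • n`. -/

namespace GorensteinModules

section Flat

/-- The relations `n r ⊗ m = n ⊗ r m` in `N ⊗[ℤ] M`, for a right module `N` and a left
module `M`. -/
def balancedRelations (R : Type u) [Ring R] (N M : Type u) [AddCommGroup N] [Module Rᵐᵒᵖ N]
    [AddCommGroup M] [Module R M] : AddSubgroup (N ⊗[ℤ] M) :=
  AddSubgroup.closure
    {t | ∃ (n : N) (r : R) (m : M), t = (MulOpposite.op r • n) ⊗ₜ[ℤ] m - n ⊗ₜ[ℤ] (r • m)}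

/-- The tensor product `N ⊗_R M` (an abelian group) over a possibly noncommutative ring. -/
abbrev BalancedTensor (R : Type u) [Ring R] (N M : Type u) [AddCommGroup N] [Module Rᵐᵒᵖ N]
    [AddCommGroup M] [Module R M] : Type u :=
  (N ⊗[ℤ] M) ⧸ balancedRelations R N M

/-- `f ⊗ id : N ⊗_R M → N' ⊗_R M`. -/
def BalancedTensor.map {R : Type u} [Ring R] {N N' : Type u} (M : Type u)
    [AddCommGroup N] [Module Rᵐᵒᵖ N] [AddCommGroup N'] [Module Rᵐᵒᵖ N']
    [AddCommGroup M] [Module R M] (f : N →ₗ[Rᵐᵒᵖ] N') :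
    BalancedTensor R N M →+ BalancedTensor R N' M :=
  QuotientAddGroup.map (balancedRelations R N M) (balancedRelations R N' M)
    (LinearMap.rTensor M f.toAddMonoidHom.toIntLinearMap).toAddMonoidHom <| by
      rw [balancedRelations, AddSubgroup.closure_le]
      rintro _ ⟨n, r, m, rfl⟩
      refine AddSubgroup.subset_closure ⟨f n, r, m, ?_⟩
      simp

/-- A left module `M` is flat if `- ⊗_R M` preserves injections of right modules. -/
def IsFlat (R : Type u) [Ring R] (M : Type u) [AddCommGroup M] [Module R M] : Prop :=
  ∀ (N N' : ModuleCat.{u} Rᵐᵒᵖ) (f : N →ₗ[Rᵐᵒᵖ] N'), Function.Injective f →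
    Function.Injective (BalancedTensor.map M f)

/-- `fd M ≤ n`: there is an exact sequence `0 → F_n → ⋯ → F_1 → F_0 → M → 0` with all `F_i` flat
(the resolution is built one step at a time, `F_0 → M` first). -/
def HasFlatDimensionLE (R : Type u) [Ring R] : ℕ → ModuleCat.{u} R → Prop
  | 0, M => IsFlat R M
  | n + 1, M => ∃ (F : ModuleCat.{u} R) (p : F →ₗ[R] M), IsFlat R F ∧ Function.Surjective p ∧
      HasFlatDimensionLE R n (ModuleCat.of R (LinearMap.ker p))

end Flat

section Gorenstein

/-- `S` is an essential submodule: it meets every nonzero submodule nontrivially. -/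
def IsEssential {R : Type u} [Ring R] {M : Type u} [AddCommGroup M] [Module R M]
    (S : Submodule R M) : Prop :=
  ∀ X : Submodule R M, X ⊓ S = ⊥ → X = ⊥

/-- A minimal injective resolution `0 → M → I 0 → I 1 → ⋯`: an exact sequence in which `I 0` is an
injective envelope of `M` and `I (n + 1)` is an injective envelope of the image of `d n`. -/
structure MinimalInjectiveResolution (R : Type u) [Ring R] (M : Type u) [AddCommGroup M]
    [Module R M] where
  I : ℕ → ModuleCat.{u} R
  ι : M →ₗ[R] I 0
  d : ∀ n, I n →ₗ[R] I (n + 1)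
  injective : ∀ n, Module.Injective R (I n)
  ι_injective : Function.Injective ι
  exact_zero : Function.Exact ι (d 0)
  exact_succ : ∀ n, Function.Exact (d n) (d (n + 1))
  essential_zero : IsEssential (LinearMap.range ι)
  essential_succ : ∀ n, IsEssential (LinearMap.range (d n))

/-- `R` is `k`-Gorenstein: in the minimal injective resolution of the left module `R`, the
`i`-th term has flat dimension at most `i` for `0 ≤ i ≤ k - 1`. (The minimal injective resolution
exists and is unique up to isomorphism.) -/
def IsKGorenstein (R : Type u) [Ring R] (k : ℕ) : Prop :=
  ∃ J : MinimalInjectiveResolution R R, ∀ i < k, HasFlatDimensionLE R i (J.I i)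

end Gorenstein

section Finitistic

/-- The big finitistic dimension: the supremum of the finite projective dimensions of left
modules (the zero module has projective dimension `⊥`). -/
noncomputable def bigFinDim (R : Type u) [Ring R] : WithBot ℕ∞ :=
  ⨆ (M : ModuleCat.{u} R) (_ : projectiveDimension M < ⊤), projectiveDimension M

/-- The small finitistic dimension: the same supremum over finitely generated left modules. -/
noncomputable def smallFinDim (R : Type u) [Ring R] : WithBot ℕ∞ :=
  ⨆ (M : ModuleCat.{u} R) (_ : Module.Finite R M) (_ : projectiveDimension M < ⊤),
    projectiveDimension M

end Finitistic

section RightModules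

/-- The dual `N^*` of a right module, a left module through `(r • f) n = r * f n`. -/
abbrev RightDual (R : Type u) [Ring R] (N : Type u) [AddCommGroup N] [Module Rᵐᵒᵖ N] : Type u :=
  N →ₗ[Rᵐᵒᵖ] R

/-- The dual `M^*` of a left module, a right module through `(f r) m = f m * r`. -/
abbrev LeftDual (R : Type u) [Ring R] (M : Type u) [AddCommGroup M] [Module R M] : Type u :=
  M →ₗ[R] R

/-- The dual `ρ^*` of a homomorphism of left modules, precomposition with `ρ`. -/
def LeftDual.map {R : Type u} [Ring R] {Y X : Type u} [AddCommGroup Y] [Module R Y]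
    [AddCommGroup X] [Module R X] (ρ : Y →ₗ[R] X) : LeftDual R X →ₗ[Rᵐᵒᵖ] LeftDual R Y where
  toFun φ := φ.comp ρ
  map_add' _ _ := rfl
  map_smul' _ _ := rfl

/-- The canonical evaluation homomorphism `σ_N : N → N^{**}`, `σ_N(x)(f) = f(x)`. -/
def evalRight (R : Type u) [Ring R] (N : Type u) [AddCommGroup N] [Module Rᵐᵒᵖ N] :
    N →ₗ[Rᵐᵒᵖ] LeftDual R (RightDual R N) where
  toFun x :=
    { toFun := fun f => f x
      map_add' := fun _ _ => rfl
      map_smul' := fun _ _ => rfl }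
  map_add' x y := LinearMap.ext fun f => f.map_add x y
  map_smul' r x := LinearMap.ext fun f => f.map_smul r x

/-- `N` is torsionless: `σ_N` is a monomorphism. -/
def IsTorsionless (R : Type u) [Ring R] (N : Type u) [AddCommGroup N] [Module Rᵐᵒᵖ N] : Prop :=
  Function.Injective (evalRight R N)

/-- `N` is reflexive: `σ_N` is an isomorphism. -/
def IsReflexive (R : Type u) [Ring R] (N : Type u) [AddCommGroup N] [Module Rᵐᵒᵖ N] : Prop :=
  Function.Bijective (evalRight R N)

/-- The reduced grade of the right module `N` is at least `k`: `Ext^j(N, R) = 0` for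
`1 ≤ j < k`, where `R` is regarded as a right module. -/
def ReducedGradeGE (R : Type u) [Ring R] (N : ModuleCat.{u} Rᵐᵒᵖ) (k : ℕ) : Prop :=
  ∀ j : ℕ, 1 ≤ j → j < k → Subsingleton (Abelian.Ext N (ModuleCat.of Rᵐᵒᵖ R) j)

/-- `N` is of `D`-class `k`, for finitely generated right modules.
* `D`-class `0`: no condition.
* `D`-class `1`: `N` is torsionless.
* `D`-class `k + 2`: `N` is torsionless and there are a finitely generated right module `T` of
  `D`-class `k + 1` and an exact sequence `0 → T^{**} → P → N → 0` with `P = Y^*` projective, whose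
  monomorphism is a double dual embedding, that is, the dual `ρ^*` of an epimorphism `ρ : Y → T^*`
  of finitely generated left modules (`ρ^*` is then automatically injective). -/
def IsDClass (R : Type u) [Ring R] : ℕ → ModuleCat.{u} Rᵐᵒᵖ → Prop
  | 0, _ => True
  | 1, N => IsTorsionless R N
  | k + 2, N => IsTorsionless R N ∧
      ∃ T : ModuleCat.{u} Rᵐᵒᵖ, Module.Finite Rᵐᵒᵖ T ∧ IsDClass R (k + 1) T ∧
        ∃ (Y : ModuleCat.{u} R) (ρ : Y →ₗ[R] RightDual R T) (π : LeftDual R Y →ₗ[Rᵐᵒᵖ] N),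
          Module.Finite R Y ∧ Function.Surjective ρ ∧
          Module.Projective Rᵐᵒᵖ (LeftDual R Y) ∧
          Function.Exact (LeftDual.map ρ) π ∧ Function.Surjective π

end RightModules

end GorensteinModules

/-!
Write `R` for the ring and `( )^*` for the dual with values in `R`. Two facts carry the proof.

*Gorenstein symmetry.* If `I` is an injective left module and `N` a finitely generated right
module, then `Hom(Ext^i(N, R), I) = Tor_i(N, I)`, which vanishes for `i > fd I`
(`linearMap_dualExt_eq_zero`). Applied to the terms of the injective resolution of `R`, this says
that every left submodule of `Ext^i(N, R)` has grade at least `i` for `1 ≤ i ≤ k + 1`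
(`extVanish_of_injective_dualExt`). What is needed is the same bound for the right modules
`E = Ext^i(M, R)`, with `M` a finitely generated left module. The module `E` is the kernel of the
map from the transpose `D` of a syzygy of `M` to the next free module of the dual complex, so
`Ext^{i-1}(E, R)` embeds into an `Ext^i`, because `Ext^{i-1}(D, R) → Ext^{i-1}(E, R)` is zero.
Hence it has grade at least `i`, which forces it to vanish (`extVanish_of_grade`,
`LeftRes.extVanish_cohomology`).

*Dual complexes.* Let `E` be a finitely generated right module with `Ext^j(E, R) = 0` for
`j ≤ k`. The dual of a free resolution of `E` resolves a left module `W` with `pd W ≤ k + 1` and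
`Ext^{k+1}(W, R) = E`. If `fin.dim R ≤ k`, then `E = 0` (`subsingleton_of_grade`). For
`E = Ext^{k+1}(M, R)` this gives `id R ≤ k`. If instead the modules of reduced grade at least
`k + 1` are torsionless, `E` embeds into `E^{**} = 0`. Conversely, the self-injective dimension
bounds all finite projective dimensions, since over a Noetherian ring it is also the injective
dimension of free modules. If `id R ≤ k` and `Ext^j(N, R) = 0` for `1 ≤ j ≤ k`, then the transpose
of `N` is a `k`-th syzygy, so `Ext^1` and `Ext^2` of it vanish and `N` is reflexive.

The `D`-classes do not involve the Gorenstein condition for `k ≥ 1`. If `T` has `D`-class `m ≥ 1`,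
then `T^*` is an `(m + 1)`-st syzygy, and a module `N` built from `T` is reflexive as soon as
`Ext^1(T^*, R) = 0` (`isReflexive_of_isDClass`). In the other direction, in the dual of a
resolution `P` of a left module `M`, the image of the `k`-th differential has `D`-class `k` and its
dual is the `(k + 1)`-st syzygy of `M`; if `pd M ≤ k + 1` this dual is projective, and reflexivity
of the image splits the resolution one step earlier (`hasProjectiveDimensionLT_of_isDClass`).

Finitely generated free modules on either side are spaces `Fin n → R` of rows or columns, and
resolutions are sequences of matrices, so that dualizing a resolution only exchanges the action on
rows with the action on columns.
-/

namespace GorensteinModules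

/-! ### Vanishing of `Ext` along short exact sequences of modules -/

section ExtVanish

variable {S : Type u} [Ring S]

/-- `Ext^n_S(M, N) = 0`, for unbundled modules. -/
def ExtVanish (S : Type u) [Ring S] (M N : Type u) [AddCommGroup M] [Module S M]
    [AddCommGroup N] [Module S N] (n : ℕ) : Prop :=
  Subsingleton (Abelian.Ext (ModuleCat.of S M) (ModuleCat.of S N) n)

variable {X Y Z T L : Type u} [AddCommGroup X] [Module S X] [AddCommGroup Y] [Module S Y]
  [AddCommGroup Z] [Module S Z] [AddCommGroup T] [Module S T] [AddCommGroup L] [Module S L]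

theorem ExtVanish.eq_zero {n : ℕ} (h : ExtVanish S X L n)
    (e : Abelian.Ext (ModuleCat.of S X) (ModuleCat.of S L) n) : e = 0 :=
  Subsingleton.elim (h := h) e 0

theorem ExtVanish.of_forall {n : ℕ}
    (h : ∀ e : Abelian.Ext (ModuleCat.of S X) (ModuleCat.of S L) n, e = 0) :
    ExtVanish S X L n :=
  ⟨fun a b => by rw [h a, h b]⟩

theorem extVanish_zero_iff : ExtVanish S X L 0 ↔ ∀ f : X →ₗ[S] L, f = 0 := by
  constructor
  · intro h f
    have h1 := h.eq_zero (Abelian.Ext.mk₀ (ModuleCat.ofHom f))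
    rw [Abelian.Ext.mk₀_eq_zero_iff] at h1
    exact congrArg ModuleCat.Hom.hom h1
  · intro h
    refine .of_forall fun e => ?_
    obtain ⟨f, rfl⟩ := Abelian.Ext.addEquiv₀.symm.surjective e
    have : f = 0 := ModuleCat.hom_ext (h f.hom)
    rw [this, map_zero]

theorem ExtVanish.of_equiv_left {n : ℕ} (h : ExtVanish S X L n) (e : X ≃ₗ[S] Y) :
    ExtVanish S Y L n := by
  refine .of_forall fun x => ?_
  rw [← Abelian.Ext.mk₀_id_comp x, ← (e.toModuleIso).inv_hom_id,
    ← Abelian.Ext.mk₀_comp_mk₀, Abelian.Ext.comp_assoc_of_second_deg_zero,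
    h.eq_zero (Abelian.Ext.comp _ x _), Abelian.Ext.comp_zero]

theorem ExtVanish.of_equiv_right {n : ℕ} (h : ExtVanish S T X n) (e : X ≃ₗ[S] Y) :
    ExtVanish S T Y n := by
  refine .of_forall fun x => ?_
  rw [← Abelian.Ext.comp_mk₀_id x, ← (e.toModuleIso).inv_hom_id,
    ← Abelian.Ext.mk₀_comp_mk₀, ← Abelian.Ext.comp_assoc_of_third_deg_zero,
    h.eq_zero (Abelian.Ext.comp x _ _), Abelian.Ext.zero_comp]

theorem extVanish_of_projective [Module.Projective S X] (n : ℕ) : ExtVanish S X L (n + 1) :=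
  haveI := (IsProjective.iff_projective (R := S) X).1 inferInstance
  .of_forall fun e => e.eq_zero_of_projective

theorem extVanish_of_injective [Module.Injective S L] (n : ℕ) : ExtVanish S X L (n + 1) :=
  haveI := (Module.injective_iff_injective_object S L).1 inferInstance
  .of_forall fun e => e.eq_zero_of_injective

theorem ExtVanish.pi {n : ℕ} (h : ExtVanish S T L n) (m : ℕ) :
    ExtVanish S T (Fin m → L) n := by
  refine .of_forall fun x => ?_
  have hid : 𝟙 (ModuleCat.of S (Fin m → L)) = ∑ i : Fin m,
      ModuleCat.ofHom (LinearMap.proj (R := S) (φ := fun _ : Fin m => L) i) ≫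
        ModuleCat.ofHom (LinearMap.single S (fun _ : Fin m => L) i) := by
    apply ModuleCat.hom_ext
    ext i y j
    simp only [ModuleCat.hom_sum, LinearMap.sum_apply, LinearMap.comp_apply, Finset.sum_apply,
      ModuleCat.hom_comp, ModuleCat.hom_ofHom, ModuleCat.hom_id, LinearMap.id_apply,
      LinearMap.proj_apply, LinearMap.single_apply]
    rw [Finset.sum_eq_single j]
    · simp
    · intro b _ hb
      rw [Pi.single_eq_of_ne (Ne.symm hb)]
    · simp
  rw [← Abelian.Ext.comp_mk₀_id x, hid, Abelian.Ext.mk₀_sum, Abelian.Ext.comp_sum]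
  refine Finset.sum_eq_zero fun i _ => ?_
  rw [← Abelian.Ext.mk₀_comp_mk₀, ← Abelian.Ext.comp_assoc_of_third_deg_zero,
    h.eq_zero (Abelian.Ext.comp x _ _), Abelian.Ext.zero_comp]

/-- `0 → X → Y → Z → 0` is a short exact sequence of modules. -/
structure IsShortExact (f : X →ₗ[S] Y) (g : Y →ₗ[S] Z) : Prop where
  inj : Function.Injective f
  exact : Function.Exact f g
  surj : Function.Surjective g

namespace IsShortExact

variable {f : X →ₗ[S] Y} {g : Y →ₗ[S] Z}

/-- The short complex in `ModuleCat` attached to a short exact sequence. -/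
abbrev complex (h : IsShortExact f g) : ShortComplex (ModuleCat.{u} S) :=
  ModuleCat.shortComplexOfCompEqZero f g h.exact.linearMap_comp_eq_zero

theorem shortExact (h : IsShortExact f g) : h.complex.ShortExact :=
  ModuleCat.shortComplex_shortExact _ h.exact h.inj h.surj

theorem subtype_mkQ (N : Submodule S Y) : IsShortExact N.subtype N.mkQ :=
  ⟨N.subtype_injective, LinearMap.exact_subtype_mkQ N, N.mkQ_surjective⟩

theorem ker_subtype {g : Y →ₗ[S] Z} (hg : Function.Surjective g) :
    IsShortExact (LinearMap.ker g).subtype g :=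
  ⟨Submodule.subtype_injective _, LinearMap.exact_subtype_ker_map g, hg⟩

theorem ker_rangeRestrict (g : Y →ₗ[S] Z) :
    IsShortExact (LinearMap.ker g).subtype g.rangeRestrict :=
  ⟨Submodule.subtype_injective _, fun x => by
    rw [← LinearMap.mem_ker, LinearMap.ker_rangeRestrict]; simp,
    LinearMap.surjective_rangeRestrict _⟩

theorem extVanish_third (h : IsShortExact f g) {n : ℕ} (hX : ExtVanish S X L n)
    (hY : ExtVanish S Y L (n + 1)) : ExtVanish S Z L (n + 1) := by
  refine .of_forall fun e => ?_
  obtain ⟨x, rfl⟩ := Abelian.Ext.contravariant_sequence_exact₃ h.shortExact _ e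
    (hY.eq_zero _) (add_comm 1 n)
  rw [hX.eq_zero x, Abelian.Ext.comp_zero]

theorem extVanish_first (h : IsShortExact f g) {n : ℕ} (hY : ExtVanish S Y L n)
    (hZ : ExtVanish S Z L (n + 1)) : ExtVanish S X L n := by
  refine .of_forall fun e => ?_
  obtain ⟨x, rfl⟩ := Abelian.Ext.contravariant_sequence_exact₁ h.shortExact _ e
    (add_comm 1 n) (hZ.eq_zero _)
  rw [hY.eq_zero x, Abelian.Ext.comp_zero]

theorem extVanish_to_third (h : IsShortExact f g) {n : ℕ} (hY : ExtVanish S T Y n)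
    (hX : ExtVanish S T X (n + 1)) : ExtVanish S T Z n := by
  refine .of_forall fun e => ?_
  obtain ⟨x, rfl⟩ := Abelian.Ext.covariant_sequence_exact₃ _ h.shortExact e rfl (hX.eq_zero _)
  rw [hY.eq_zero x, Abelian.Ext.zero_comp]

theorem extVanish_to_first (h : IsShortExact f g) {n : ℕ} (hZ : ExtVanish S T Z n)
    (hY : ExtVanish S T Y (n + 1)) : ExtVanish S T X (n + 1) := by
  refine .of_forall fun e => ?_
  obtain ⟨x, rfl⟩ := Abelian.Ext.covariant_sequence_exact₁ _ h.shortExact e (hY.eq_zero _) rfl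
  rw [hZ.eq_zero x, Abelian.Ext.zero_comp]

theorem extend_of_extVanish (h : IsShortExact f g) (hZ : ExtVanish S Z L 1) (φ : X →ₗ[S] L) :
    ∃ ψ : Y →ₗ[S] L, ψ ∘ₗ f = φ := by
  obtain ⟨x, hx⟩ := Abelian.Ext.contravariant_sequence_exact₁ h.shortExact _
    (Abelian.Ext.mk₀ (ModuleCat.ofHom φ)) (add_comm 1 0) (hZ.eq_zero _)
  obtain ⟨ψ, rfl⟩ := (Abelian.Ext.mk₀_bijective _ _).surjective x
  rw [Abelian.Ext.mk₀_comp_mk₀] at hx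
  exact ⟨ψ.hom, congrArg ModuleCat.Hom.hom ((Abelian.Ext.mk₀_bijective _ _).injective hx)⟩

theorem extVanish_of_extend (h : IsShortExact f g) (hY : ExtVanish S Y L 1)
    (H : ∀ φ : X →ₗ[S] L, ∃ ψ : Y →ₗ[S] L, ψ ∘ₗ f = φ) : ExtVanish S Z L 1 := by
  refine .of_forall fun e => ?_
  obtain ⟨x, rfl⟩ := Abelian.Ext.contravariant_sequence_exact₃ h.shortExact _ e
    (hY.eq_zero _) (add_comm 1 0)
  obtain ⟨φ, rfl⟩ := (Abelian.Ext.mk₀_bijective _ _).surjective x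
  obtain ⟨ψ, hψ⟩ := H φ.hom
  have : φ = h.complex.f ≫ ModuleCat.ofHom ψ := ModuleCat.hom_ext hψ.symm
  rw [this, ← Abelian.Ext.mk₀_comp_mk₀, ← Abelian.Ext.comp_assoc_of_second_deg_zero,
    h.shortExact.extClass_comp, Abelian.Ext.zero_comp]

end IsShortExact

end ExtVanish

/-! ### Matrices acting on rows, on columns, and on columns over a left module -/

section Matrices

variable {R : Type u} [Ring R] {a b c : ℕ}

/-- The left linear map `x ↦ x d` on row vectors. -/
abbrev rowMap (d : Matrix (Fin b) (Fin a) R) : (Fin b → R) →ₗ[R] (Fin a → R) :=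
  Matrix.vecMulLinear d

/-- The right linear map `v ↦ d v` on column vectors. -/
def colMap (d : Matrix (Fin c) (Fin b) R) : (Fin b → R) →ₗ[Rᵐᵒᵖ] (Fin c → R) where
  toFun v := d.mulVec v
  map_add' := d.mulVec_add
  map_smul' r v := d.mulVec_smul r v

@[simp] theorem colMap_apply (d : Matrix (Fin c) (Fin b) R) (v : Fin b → R) :
    colMap d v = d.mulVec v := rfl

/-- The additive map `x ↦ d x` on column vectors with entries in a left module; this is
`d ⊗ id` under the identification of `R ^ b ⊗ M` with `M ^ b`. -/
def matAct (M : Type u) [AddCommGroup M] [Module R M] (d : Matrix (Fin c) (Fin b) R) :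
    (Fin b → M) →+ (Fin c → M) where
  toFun x i := ∑ j, d i j • x j
  map_zero' := by ext; simp
  map_add' x y := by ext; simp [Finset.sum_add_distrib]

variable {M N : Type u} [AddCommGroup M] [Module R M] [AddCommGroup N] [Module R N]

theorem matAct_apply (d : Matrix (Fin c) (Fin b) R) (x : Fin b → M) (i : Fin c) :
    matAct M d x i = ∑ j, d i j • x j := rfl

theorem matAct_matAct (d : Matrix (Fin c) (Fin b) R) (d' : Matrix (Fin b) (Fin a) R)
    (x : Fin a → M) : matAct M d (matAct M d' x) = matAct M (d * d') x := by
  ext i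
  simp only [matAct_apply, Matrix.mul_apply, Finset.smul_sum, Finset.sum_smul, smul_smul]
  exact Finset.sum_comm

theorem matAct_zero (x : Fin b → M) : matAct M (0 : Matrix (Fin c) (Fin b) R) x = 0 := by
  ext i; simp [matAct_apply]

theorem matAct_comp (f : M →ₗ[R] N) (d : Matrix (Fin c) (Fin b) R) (x : Fin b → M) :
    matAct N d (fun j => f (x j)) = fun i => f (matAct M d x i) := by
  ext i; simp [matAct_apply, map_sum]

/-- A left linear map out of `R ^ n` is determined by the images of the basis vectors. -/
theorem leftLinear_apply (φ : (Fin b → R) →ₗ[R] M) (x : Fin b → R) :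
    φ x = ∑ i, x i • φ (Pi.single i 1) := by
  rw [LinearMap.pi_apply_eq_sum_univ φ x]
  refine Finset.sum_congr rfl fun i _ => ?_
  congr 2
  ext j
  simp [Pi.single_apply, eq_comm]

theorem col_eq_sum (v : Fin b → R) :
    v = ∑ i, MulOpposite.op (v i) • (Pi.single i 1 : Fin b → R) := by
  ext j
  simp [Finset.sum_apply, Pi.single_apply]

theorem rightLinear_apply {N : Type u} [AddCommGroup N] [Module Rᵐᵒᵖ N]
    (φ : (Fin b → R) →ₗ[Rᵐᵒᵖ] N) (v : Fin b → R) :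
    φ v = ∑ i, MulOpposite.op (v i) • φ (Pi.single i 1) := by
  conv_lhs => rw [col_eq_sum v]
  simp [map_sum]

/-- Left functionals on row vectors are columns. -/
theorem leftFunctional_apply (φ : (Fin b → R) →ₗ[R] R) (x : Fin b → R) :
    φ x = x ⬝ᵥ fun i => φ (Pi.single i 1) := by
  rw [leftLinear_apply]; rfl

/-- Right functionals on column vectors are rows. -/
theorem rightFunctional_apply (φ : (Fin b → R) →ₗ[Rᵐᵒᵖ] R) (v : Fin b → R) :
    φ v = (fun i => φ (Pi.single i 1)) ⬝ᵥ v := by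
  rw [rightLinear_apply]; rfl

/-- The left functional on rows given by a column. -/
def ofCol (v : Fin b → R) : (Fin b → R) →ₗ[R] R where
  toFun x := x ⬝ᵥ v
  map_add' x y := add_dotProduct x y v
  map_smul' r x := smul_dotProduct r x v

@[simp] theorem ofCol_apply (v x : Fin b → R) : ofCol v x = x ⬝ᵥ v := rfl

/-- The right functional on columns given by a row. -/
def ofRow (x : Fin b → R) : (Fin b → R) →ₗ[Rᵐᵒᵖ] R where
  toFun v := x ⬝ᵥ v
  map_add' v w := dotProduct_add x v w
  map_smul' r v := dotProduct_smul r x v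

@[simp] theorem ofRow_apply (x v : Fin b → R) : ofRow x v = x ⬝ᵥ v := rfl

/-- `R` as a right module over itself is isomorphic to `Rᵐᵒᵖ` as a left module over itself. -/
def opEquiv (R : Type u) [Ring R] : R ≃ₗ[Rᵐᵒᵖ] Rᵐᵒᵖ where
  __ := MulOpposite.opAddEquiv
  map_smul' r x := by
    obtain ⟨s, rfl⟩ := MulOpposite.op_surjective r
    rfl

instance free_right : Module.Free Rᵐᵒᵖ R := .of_equiv (opEquiv R).symm

instance finite_right : Module.Finite Rᵐᵒᵖ R := .equiv (opEquiv R).symm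

instance noetherian_right [IsNoetherianRing Rᵐᵒᵖ] : IsNoetherian Rᵐᵒᵖ R :=
  isNoetherian_of_linearEquiv (opEquiv R).symm

theorem exists_col_surjective (N : Type u) [AddCommGroup N] [Module Rᵐᵒᵖ N]
    [Module.Finite Rᵐᵒᵖ N] :
    ∃ (n : ℕ) (p : (Fin n → R) →ₗ[Rᵐᵒᵖ] N), Function.Surjective p := by
  obtain ⟨n, p, hp⟩ := Module.Finite.exists_fin' Rᵐᵒᵖ N
  exact ⟨n, p ∘ₗ (LinearEquiv.piCongrRight fun _ : Fin n => opEquiv R).toLinearMap,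
    hp.comp (LinearEquiv.surjective _)⟩

theorem exists_range_colMap (C : Submodule Rᵐᵒᵖ (Fin a → R)) [Module.Finite Rᵐᵒᵖ C] :
    ∃ (n : ℕ) (d : Matrix (Fin a) (Fin n) R), LinearMap.range (colMap d) = C := by
  obtain ⟨n, p, hp⟩ := exists_col_surjective (R := R) C
  refine ⟨n, Matrix.of fun i j => (p (Pi.single j 1) : Fin a → R) i, ?_⟩
  have : colMap (Matrix.of fun i j => (p (Pi.single j 1) : Fin a → R) i) = C.subtype ∘ₗ p := by
    refine LinearMap.ext fun v => funext fun i => ?_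
    rw [LinearMap.comp_apply, rightLinear_apply p v]
    simp [Matrix.mulVec, dotProduct, Finset.sum_apply]
  rw [this, LinearMap.range_comp, LinearMap.range_eq_top.2 hp, Submodule.map_top,
    Submodule.range_subtype]

theorem exists_range_rowMap (C : Submodule R (Fin a → R)) [Module.Finite R C] :
    ∃ (n : ℕ) (d : Matrix (Fin n) (Fin a) R), LinearMap.range (rowMap d) = C := by
  obtain ⟨n, p, hp⟩ := Module.Finite.exists_fin' R C
  refine ⟨n, Matrix.of fun j i => (p (Pi.single j 1) : Fin a → R) i, ?_⟩
  have : rowMap (Matrix.of fun j i => (p (Pi.single j 1) : Fin a → R) i) = C.subtype ∘ₗ p := by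
    refine LinearMap.ext fun v => funext fun i => ?_
    rw [LinearMap.comp_apply, leftLinear_apply p v]
    simp [Matrix.vecMul, dotProduct, Finset.sum_apply]
  rw [this, LinearMap.range_comp, LinearMap.range_eq_top.2 hp, Submodule.map_top,
    Submodule.range_subtype]

end Matrices

/-! ### Resolutions by finitely generated free modules -/

section Resolutions

variable (R : Type u) [Ring R]

/-- A resolution `⋯ → R ^ (rank 1) → R ^ (rank 0)` by free left modules of row vectors, the
differential being right multiplication by `d n`. It resolves the cokernel of `d 0`. -/
structure LeftRes where
  rank : ℕ → ℕ
  d : ∀ n, Matrix (Fin (rank (n + 1))) (Fin (rank n)) R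
  comp : ∀ n, d (n + 1) * d n = 0
  exact : ∀ n x, Matrix.vecMul x (d n) = 0 → ∃ y, Matrix.vecMul y (d (n + 1)) = x

/-- A resolution `⋯ → R ^ (rank 1) → R ^ (rank 0)` by free right modules of column vectors, the
differential being left multiplication by `d n`. It resolves the cokernel of `d 0`. -/
structure RightRes where
  rank : ℕ → ℕ
  d : ∀ n, Matrix (Fin (rank n)) (Fin (rank (n + 1))) R
  comp : ∀ n, d n * d (n + 1) = 0
  exact : ∀ n v, Matrix.mulVec (d n) v = 0 → ∃ w, Matrix.mulVec (d (n + 1)) w = v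

variable {R}

/-- The resolution of the first syzygy. -/
def LeftRes.shift (P : LeftRes R) : LeftRes R where
  rank n := P.rank (n + 1)
  d n := P.d (n + 1)
  comp n := P.comp (n + 1)
  exact n := P.exact (n + 1)

/-- The resolution of the first syzygy. -/
def RightRes.shift (P : RightRes R) : RightRes R where
  rank n := P.rank (n + 1)
  d n := P.d (n + 1)
  comp n := P.comp (n + 1)
  exact n := P.exact (n + 1)

theorem LeftRes.ker_eq_range (P : LeftRes R) (n : ℕ) :
    LinearMap.ker (rowMap (P.d n)) = LinearMap.range (rowMap (P.d (n + 1))) := by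
  ext x
  constructor
  · intro h; exact P.exact n x h
  · rintro ⟨y, rfl⟩
    simp [Matrix.vecMul_vecMul, P.comp]

theorem RightRes.ker_eq_range (P : RightRes R) (n : ℕ) :
    LinearMap.ker (colMap (P.d n)) = LinearMap.range (colMap (P.d (n + 1))) := by
  ext x
  constructor
  · intro h; exact P.exact n x h
  · rintro ⟨y, rfl⟩
    simp [Matrix.mulVec_mulVec, P.comp]

theorem exists_leftRes [IsNoetherianRing R] (M : Type u) [AddCommGroup M] [Module R M]
    [Module.Finite R M] : ∃ (P : LeftRes R) (p : (Fin (P.rank 0) → R) →ₗ[R] M),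
      Function.Surjective p ∧ LinearMap.ker p = LinearMap.range (rowMap (P.d 0)) := by
  obtain ⟨n, p, hp⟩ := Module.Finite.exists_fin' R M
  choose! f g hg using fun (a : ℕ) (C : Submodule R (Fin a → R)) => exists_range_rowMap C
  let s : ℕ → (a : ℕ) × Submodule R (Fin a → R) := fun m =>
    Nat.rec ⟨n, LinearMap.ker p⟩ (fun _ t => ⟨f t.1 t.2, LinearMap.ker (rowMap (g t.1 t.2))⟩) m
  have key : ∀ m, LinearMap.ker (rowMap (g (s m).1 (s m).2)) =
      LinearMap.range (rowMap (g (s (m + 1)).1 (s (m + 1)).2)) := fun m => (hg _ _).symm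
  refine ⟨⟨fun m => (s m).1, fun m => g (s m).1 (s m).2, fun m => ?_, fun m x hx => ?_⟩, p, hp,
    (hg _ _).symm⟩
  · ext i j
    have : Matrix.vecMul (Pi.single i 1) (g (s (m + 1)).1 (s (m + 1)).2) ∈
        LinearMap.ker (rowMap (g (s m).1 (s m).2)) := by
      rw [key]; exact ⟨_, rfl⟩
    have h2 := congrFun (LinearMap.mem_ker.1 this) j
    simp only [Matrix.vecMulLinear_apply, Matrix.single_one_vecMul] at h2
    exact h2
  · have : x ∈ LinearMap.ker (rowMap (g (s m).1 (s m).2)) := hx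
    rw [key] at this
    exact this

theorem exists_rightRes [IsNoetherianRing Rᵐᵒᵖ] (N : Type u) [AddCommGroup N] [Module Rᵐᵒᵖ N]
    [Module.Finite Rᵐᵒᵖ N] : ∃ (P : RightRes R) (p : (Fin (P.rank 0) → R) →ₗ[Rᵐᵒᵖ] N),
      Function.Surjective p ∧ LinearMap.ker p = LinearMap.range (colMap (P.d 0)) := by
  obtain ⟨n, p, hp⟩ := exists_col_surjective (R := R) N
  choose! f g hg using fun (a : ℕ) (C : Submodule Rᵐᵒᵖ (Fin a → R)) => exists_range_colMap C
  let s : ℕ → (a : ℕ) × Submodule Rᵐᵒᵖ (Fin a → R) := fun m =>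
    Nat.rec ⟨n, LinearMap.ker p⟩ (fun _ t => ⟨f t.1 t.2, LinearMap.ker (colMap (g t.1 t.2))⟩) m
  have key : ∀ m, LinearMap.ker (colMap (g (s m).1 (s m).2)) =
      LinearMap.range (colMap (g (s (m + 1)).1 (s (m + 1)).2)) := fun m => (hg _ _).symm
  refine ⟨⟨fun m => (s m).1, fun m => g (s m).1 (s m).2, fun m => ?_, fun m x hx => ?_⟩, p, hp,
    (hg _ _).symm⟩
  · ext i j
    have : Matrix.mulVec (g (s (m + 1)).1 (s (m + 1)).2) (Pi.single j 1) ∈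
        LinearMap.ker (colMap (g (s m).1 (s m).2)) := by
      rw [key]; exact ⟨_, rfl⟩
    have h2 := congrFun (LinearMap.mem_ker.1 this) i
    simp only [colMap_apply, Matrix.mulVec_single_one] at h2
    exact h2
  · have : x ∈ LinearMap.ker (colMap (g (s m).1 (s m).2)) := hx
    rw [key] at this
    exact this

end Resolutions

/-! ### Flat dimension and exactness of `P ⊗ I` -/

section FlatDimension

variable {R : Type u} [Ring R] {a b c : ℕ}

theorem IsFlat.matAct_exact {F : Type u} [AddCommGroup F] [Module R F] (hF : IsFlat R F)
    (d : Matrix (Fin c) (Fin b) R) (d' : Matrix (Fin b) (Fin a) R) (hdd : d * d' = 0)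
    (hex : ∀ v, d.mulVec v = 0 → ∃ w, d'.mulVec w = v) (x : Fin b → F)
    (hx : matAct F d x = 0) : ∃ y, matAct F d' y = x := by
  -- `R ^ b / im d'` embeds into `R ^ c`; its tensor product with `F` is `F ^ b / im d'`.
  let W := LinearMap.range (colMap d')
  have hW : W ≤ LinearMap.ker (colMap d) := by
    rintro _ ⟨w, rfl⟩
    simp [Matrix.mulVec_mulVec, hdd]
  let f : ((Fin b → R) ⧸ W) →ₗ[Rᵐᵒᵖ] (Fin c → R) := W.liftQ (colMap d) hW
  have hf : Function.Injective f := by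
    rw [← LinearMap.ker_eq_bot, Submodule.ker_liftQ_eq_bot]
    intro v hv
    exact hex v hv
  have hinj := hF (ModuleCat.of Rᵐᵒᵖ ((Fin b → R) ⧸ W)) (ModuleCat.of Rᵐᵒᵖ (Fin c → R)) f hf
  let t : BalancedTensor R ((Fin b → R) ⧸ W) F :=
    ∑ j, QuotientAddGroup.mk' _ (W.mkQ (Pi.single j 1) ⊗ₜ[ℤ] x j)
  have hbal : ∀ (n : Fin c → R) (r : R) (m : F),
      (QuotientAddGroup.mk' (balancedRelations R (Fin c → R) F))
        ((MulOpposite.op r • n) ⊗ₜ[ℤ] m) = QuotientAddGroup.mk' _ (n ⊗ₜ[ℤ] (r • m)) := by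
    intro n r m
    rw [← sub_eq_zero, ← map_sub]
    exact (QuotientAddGroup.eq_zero_iff _).2 (AddSubgroup.subset_closure ⟨n, r, m, rfl⟩)
  have hmap : BalancedTensor.map F f t = 0 := by
    have h1 : ∀ j, BalancedTensor.map F f
        (QuotientAddGroup.mk' _ (W.mkQ (Pi.single j 1) ⊗ₜ[ℤ] x j)) =
        ∑ i, QuotientAddGroup.mk' (balancedRelations R (Fin c → R) F)
          (Pi.single i 1 ⊗ₜ[ℤ] (d i j • x j)) := by
      intro j
      have h2 : BalancedTensor.map F f
          (QuotientAddGroup.mk' _ (W.mkQ (Pi.single j 1) ⊗ₜ[ℤ] x j)) =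
          QuotientAddGroup.mk' (balancedRelations R (Fin c → R) F)
            (colMap d (Pi.single j 1) ⊗ₜ[ℤ] x j) := rfl
      rw [h2, col_eq_sum (colMap d (Pi.single j 1)), TensorProduct.sum_tmul, map_sum]
      refine Finset.sum_congr rfl fun i _ => ?_
      rw [hbal]
      simp
    simp only [t, map_sum, h1]
    rw [Finset.sum_comm]
    simp only [← map_sum, ← TensorProduct.tmul_sum]
    have h3 : ∀ i, ∑ j, d i j • x j = 0 := fun i => congrFun hx i
    simp [h3]
  have ht : t = 0 := hinj (hmap.trans (map_zero _).symm)
  let Q := (Fin b → F) ⧸ (matAct F d').range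
  let β : (Fin b → R) →+ F →+ Q :=
    { toFun := fun v => (QuotientAddGroup.mk' (matAct F d').range).comp
        { toFun := fun m i => v i • m
          map_zero' := by ext; simp
          map_add' := fun m m' => by ext; simp }
      map_zero' := by
        ext m
        change QuotientAddGroup.mk' (matAct F d').range (fun i => (0 : Fin b → R) i • m) = 0
        rw [← map_zero (QuotientAddGroup.mk' (matAct F d').range)]
        congr 1
        ext; simp
      map_add' := fun v w => by
        ext m
        change QuotientAddGroup.mk' (matAct F d').range (fun i => (v + w) i • m) =
          QuotientAddGroup.mk' _ (fun i => v i • m) + QuotientAddGroup.mk' _ (fun i => w i • m)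
        rw [← map_add]
        congr 1
        ext; simp [add_smul] }
  have hβ : ∀ v ∈ W.toAddSubgroup, β v = 0 := by
    rintro _ ⟨w, rfl⟩
    ext m
    refine (QuotientAddGroup.eq_zero_iff _).2 ⟨fun i => w i • m, ?_⟩
    ext i
    simp [matAct_apply, Matrix.mulVec, dotProduct, Finset.sum_smul, smul_smul]
  let β' : ((Fin b → R) ⧸ W) →+ F →+ Q := QuotientAddGroup.lift W.toAddSubgroup β hβ
  let Φ : ((Fin b → R) ⧸ W) ⊗[ℤ] F →+ Q :=
    TensorProduct.liftAddHom β' fun r m n => by rw [map_zsmul, map_zsmul]; rfl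
  have hΦ : balancedRelations R ((Fin b → R) ⧸ W) F ≤ Φ.ker := by
    rw [balancedRelations, AddSubgroup.closure_le]
    rintro _ ⟨n, r, m, rfl⟩
    obtain ⟨v, rfl⟩ := W.mkQ_surjective n
    change Φ _ = 0
    rw [map_sub, sub_eq_zero]
    change (QuotientAddGroup.mk' (matAct F d').range) _ = QuotientAddGroup.mk' _ _
    congr 1
    ext i
    exact mul_smul (v i) r m
  let Ψ : BalancedTensor R ((Fin b → R) ⧸ W) F →+ Q := QuotientAddGroup.lift _ Φ hΦ
  have hΨ : Ψ t = QuotientAddGroup.mk' (matAct F d').range x := by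
    have h1 : ∀ j, Ψ (QuotientAddGroup.mk' _ (W.mkQ (Pi.single j 1) ⊗ₜ[ℤ] x j)) =
        QuotientAddGroup.mk' (matAct F d').range
          (fun i => (Pi.single j 1 : Fin b → R) i • x j) := fun j => rfl
    simp only [t, map_sum, h1]
    rw [← map_sum]
    congr 1
    ext i
    simp [Finset.sum_apply, Pi.single_apply]
  rw [ht, map_zero] at hΨ
  exact (QuotientAddGroup.eq_zero_iff _).1 hΨ.symm

/-- A module of flat dimension at most `n` has no `Tor` in degrees above `n`. -/
theorem HasFlatDimensionLE.matAct_exact (P : RightRes R) :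
    ∀ (n : ℕ) (M : ModuleCat.{u} R), HasFlatDimensionLE R n M → ∀ i, n ≤ i →
      ∀ x : Fin (P.rank (i + 1)) → M, matAct M (P.d i) x = 0 →
        ∃ y, matAct M (P.d (i + 1)) y = x
  | 0, M, hM, i, _, x, hx => IsFlat.matAct_exact hM _ _ (P.comp i) (P.exact i) x hx
  | n + 1, M, ⟨F, p, hF, hp, hK⟩, i + 1, hi, x, hx => by
    have ih := HasFlatDimensionLE.matAct_exact P n _ hK i (by omega)
    choose s hs using hp
    let x' : Fin (P.rank (i + 1 + 1)) → F := fun j => s (x j)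
    have hx' : (fun j => p (x' j)) = x := funext fun j => hs _
    have hk : ∀ j, matAct F (P.d (i + 1)) x' j ∈ LinearMap.ker p := by
      intro j
      have := congrFun (matAct_comp p (P.d (i + 1)) x') j
      rw [hx', hx] at this
      exact this.symm
    let z : Fin (P.rank (i + 1)) → LinearMap.ker p := fun j => ⟨_, hk j⟩
    have hz : (fun j => (LinearMap.ker p).subtype (z j)) = matAct F (P.d (i + 1)) x' := rfl
    obtain ⟨w, hw⟩ := ih z <| by
      have h1 := matAct_comp (LinearMap.ker p).subtype (P.d i) z
      rw [hz, matAct_matAct, P.comp, matAct_zero] at h1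
      ext j
      exact (congrFun h1 j).symm
    let w' : Fin (P.rank (i + 1 + 1)) → F := fun j => (LinearMap.ker p).subtype (w j)
    have hw' : matAct F (P.d (i + 1)) w' = matAct F (P.d (i + 1)) x' := by
      have h1 := matAct_comp (LinearMap.ker p).subtype (P.d (i + 1)) w
      have hw2 : matAct (LinearMap.ker p) (P.d (i + 1)) w = z := hw
      rw [hw2] at h1
      exact h1
    obtain ⟨y, hy⟩ := IsFlat.matAct_exact hF _ _ (P.comp (i + 1)) (P.exact (i + 1)) (x' - w')
      (by rw [map_sub, hw', sub_self])
    refine ⟨fun j => p (y j), ?_⟩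
    rw [matAct_comp p, hy, ← hx']
    ext j
    have : p (w' j) = 0 := (w j).2
    simp [this]

end FlatDimension

/-! ### `Ext` of a right module with values in the ring, as a left module -/

section DualExt

variable (R : Type u) [Ring R]

/-- Left multiplication by `r`, as an endomorphism of the right module `R`. -/
def mulLeftRight (r : R) : R →ₗ[Rᵐᵒᵖ] R where
  toFun x := r * x
  map_add' := mul_add r
  map_smul' s x := (mul_assoc r x s.unop).symm

/-- `Ext^n(N, R)` for a right module `N`, to be regarded as a left module: `r` acts by composition
with the endomorphism `x ↦ r * x` of the right module `R`. -/
abbrev DualExt (N : Type u) [AddCommGroup N] [Module Rᵐᵒᵖ N] (n : ℕ) : Type u :=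
  Abelian.Ext (ModuleCat.of Rᵐᵒᵖ N) (ModuleCat.of Rᵐᵒᵖ R) n

variable {R}
variable {X Y Z N : Type u} [AddCommGroup X] [Module Rᵐᵒᵖ X] [AddCommGroup Y] [Module Rᵐᵒᵖ Y]
  [AddCommGroup Z] [Module Rᵐᵒᵖ Z] [AddCommGroup N] [Module Rᵐᵒᵖ N]

noncomputable instance dualExtModule (n : ℕ) : Module R (DualExt R N n) where
  smul r e := Abelian.Ext.comp e (Abelian.Ext.mk₀ (ModuleCat.ofHom (mulLeftRight R r)))
    (add_zero n)
  one_smul e := by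
    have : ModuleCat.ofHom (mulLeftRight R 1) = 𝟙 _ := by
      ext; exact one_mul _
    change Abelian.Ext.comp e (Abelian.Ext.mk₀ (ModuleCat.ofHom (mulLeftRight R 1))) _ = e
    rw [this]
    exact Abelian.Ext.comp_mk₀_id e
  mul_smul r s e := by
    have : ModuleCat.ofHom (mulLeftRight R (r * s)) =
        ModuleCat.ofHom (mulLeftRight R s) ≫ ModuleCat.ofHom (mulLeftRight R r) := by
      ext; exact mul_assoc _ _ _
    change Abelian.Ext.comp e (Abelian.Ext.mk₀ (ModuleCat.ofHom (mulLeftRight R (r * s)))) _ =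
      Abelian.Ext.comp (Abelian.Ext.comp e _ _) _ _
    rw [this, ← Abelian.Ext.mk₀_comp_mk₀, Abelian.Ext.comp_assoc_of_third_deg_zero]
  smul_zero r := Abelian.Ext.zero_comp _ _ _ _ (add_zero n)
  smul_add r e e' := Abelian.Ext.add_comp _ _ _ _
  add_smul r s e := by
    have : ModuleCat.ofHom (mulLeftRight R (r + s)) =
        ModuleCat.ofHom (mulLeftRight R r) + ModuleCat.ofHom (mulLeftRight R s) := by
      ext; exact add_mul _ _ _
    change Abelian.Ext.comp e (Abelian.Ext.mk₀ (ModuleCat.ofHom (mulLeftRight R (r + s)))) _ = _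
    rw [this, Abelian.Ext.mk₀_add, Abelian.Ext.comp_add]
    rfl
  zero_smul e := by
    have : ModuleCat.ofHom (mulLeftRight R (0 : R)) = 0 := by
      ext; exact zero_mul _
    change Abelian.Ext.comp e (Abelian.Ext.mk₀ (ModuleCat.ofHom (mulLeftRight R 0))) _ = _
    rw [this, Abelian.Ext.mk₀_zero, Abelian.Ext.comp_zero]

/-- The connecting homomorphism of left modules attached to a short exact sequence of right
modules. -/
noncomputable def connecting {f : X →ₗ[Rᵐᵒᵖ] Y} {g : Y →ₗ[Rᵐᵒᵖ] Z} (h : IsShortExact f g)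
    (n : ℕ) : DualExt R X n →ₗ[R] DualExt R Z (n + 1) where
  toFun e := h.shortExact.extClass.comp e (add_comm 1 n)
  map_add' e e' := Abelian.Ext.comp_add _ _ _ _
  map_smul' r e := by
    change Abelian.Ext.comp _ (Abelian.Ext.comp e _ _) _ =
      Abelian.Ext.comp (Abelian.Ext.comp _ _ _) _ _
    rw [Abelian.Ext.comp_assoc_of_third_deg_zero]

theorem connecting_injective {f : X →ₗ[Rᵐᵒᵖ] Y} {g : Y →ₗ[Rᵐᵒᵖ] Z} (h : IsShortExact f g)
    (n : ℕ) (H : ∀ e : Abelian.Ext (ModuleCat.of Rᵐᵒᵖ Y) (ModuleCat.of Rᵐᵒᵖ R) n,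
      (Abelian.Ext.mk₀ h.complex.f).comp e (zero_add n) = 0) :
    Function.Injective (connecting h n) := by
  rw [← LinearMap.ker_eq_bot, LinearMap.ker_eq_bot']
  intro e he
  obtain ⟨x, rfl⟩ := Abelian.Ext.contravariant_sequence_exact₁ h.shortExact _ e
    (add_comm 1 n) he
  exact H x

theorem connecting_surjective {f : X →ₗ[Rᵐᵒᵖ] Y} {g : Y →ₗ[Rᵐᵒᵖ] Z} (h : IsShortExact f g)
    (n : ℕ) (hY : ExtVanish Rᵐᵒᵖ Y R (n + 1)) : Function.Surjective (connecting h n) := by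
  intro e
  exact Abelian.Ext.contravariant_sequence_exact₃ h.shortExact _ e (hY.eq_zero _) (add_comm 1 n)

/-- `Ext^0(N, R)` is the dual of `N`. -/
noncomputable def dualExtZeroEquiv : RightDual R N ≃ₗ[R] DualExt R N 0 where
  toFun f := Abelian.Ext.mk₀ (ModuleCat.ofHom f)
  map_add' f g := Abelian.Ext.mk₀_add (ModuleCat.ofHom f) (ModuleCat.ofHom g)
  map_smul' r f := by
    change _ = Abelian.Ext.comp _ _ _
    simp only [RingHom.id_apply]
    rw [Abelian.Ext.mk₀_comp_mk₀]
    rfl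
  invFun e := (Abelian.Ext.homEquiv₀ e).hom
  left_inv f := by
    exact congrArg ModuleCat.Hom.hom
      (Abelian.Ext.homEquiv₀.apply_symm_apply (ModuleCat.ofHom f))
  right_inv e := by
    exact Abelian.Ext.mk₀_homEquiv₀_apply e

theorem connecting_dualExtZeroEquiv_eq_zero_iff {f : X →ₗ[Rᵐᵒᵖ] Y} {g : Y →ₗ[Rᵐᵒᵖ] Z}
    (h : IsShortExact f g) (φ : RightDual R X) :
    connecting h 0 (dualExtZeroEquiv φ) = 0 ↔ ∃ ψ : RightDual R Y, ψ ∘ₗ f = φ := by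
  constructor
  · intro h0
    obtain ⟨x, hx⟩ := Abelian.Ext.contravariant_sequence_exact₁ h.shortExact _
      (Abelian.Ext.mk₀ (ModuleCat.ofHom φ)) (add_comm 1 0) h0
    obtain ⟨ψ, rfl⟩ := (Abelian.Ext.mk₀_bijective _ _).surjective x
    rw [Abelian.Ext.mk₀_comp_mk₀] at hx
    exact ⟨ψ.hom, congrArg ModuleCat.Hom.hom ((Abelian.Ext.mk₀_bijective _ _).injective hx)⟩
  · rintro ⟨ψ, rfl⟩
    change Abelian.Ext.comp _ (Abelian.Ext.mk₀ (h.complex.f ≫ ModuleCat.ofHom ψ))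
      (add_comm 1 0) = 0
    rw [← Abelian.Ext.mk₀_comp_mk₀, ← Abelian.Ext.comp_assoc_of_second_deg_zero,
      h.shortExact.extClass_comp, Abelian.Ext.zero_comp]

/-- A linear map that kills the kernel of a surjection factors through it. -/
theorem exists_factor {S : Type u} [Ring S] {A B L : Type u} [AddCommGroup A] [Module S A]
    [AddCommGroup B] [Module S B] [AddCommGroup L] [Module S L] (q : A →ₗ[S] B)
    (hq : Function.Surjective q) (g : A →ₗ[S] L) (hg : LinearMap.ker q ≤ LinearMap.ker g) :
    ∃ φ : B →ₗ[S] L, φ ∘ₗ q = g := by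
  refine ⟨(LinearMap.ker q).liftQ g hg ∘ₗ (q.quotKerEquivOfSurjective hq).symm.toLinearMap, ?_⟩
  ext x
  have : (q.quotKerEquivOfSurjective hq).symm (q x) = (LinearMap.ker q).mkQ x := by
    rw [LinearEquiv.symm_apply_eq]; rfl
  simp [this]

/-- The row of values of a functional on the generators of a presented right module. -/
def rightDualRow {a b : ℕ} (d : Matrix (Fin b) (Fin a) R) (q : (Fin b → R) →ₗ[Rᵐᵒᵖ] N)
    (hd : LinearMap.ker q = LinearMap.range (colMap d)) :
    RightDual R N →ₗ[R] LinearMap.ker (rowMap d) where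
  toFun f := ⟨fun i => f (q (Pi.single i 1)), by
    ext j
    have h1 : q (d.mulVec (Pi.single j 1)) = 0 := by
      rw [← LinearMap.mem_ker, hd]; exact ⟨_, rfl⟩
    have h2 := rightFunctional_apply (f ∘ₗ q) (d.mulVec (Pi.single j 1))
    rw [LinearMap.comp_apply, h1, map_zero, Matrix.dotProduct_mulVec, dotProduct_single_one] at h2
    exact h2.symm⟩
  map_add' f g := rfl
  map_smul' r f := rfl

/-- The dual of the cokernel of a matrix is the kernel of its action on rows. -/
noncomputable def rightDualEquiv {a b : ℕ} (d : Matrix (Fin b) (Fin a) R)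
    (q : (Fin b → R) →ₗ[Rᵐᵒᵖ] N) (hq : Function.Surjective q)
    (hd : LinearMap.ker q = LinearMap.range (colMap d)) :
    RightDual R N ≃ₗ[R] LinearMap.ker (rowMap d) :=
  LinearEquiv.ofBijective (rightDualRow d q hd) <| by
    constructor
    · rw [← LinearMap.ker_eq_bot, LinearMap.ker_eq_bot']
      intro f hf
      ext x
      obtain ⟨v, rfl⟩ := hq x
      have h2 := rightFunctional_apply (f ∘ₗ q) v
      have h3 : (fun i => (f ∘ₗ q) (Pi.single i 1)) = 0 := congrArg Subtype.val hf
      rw [h3, zero_dotProduct] at h2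
      exact h2
    · rintro ⟨x, hx⟩
      obtain ⟨φ, hφ⟩ := exists_factor q hq (ofRow x) (by
        rw [hd]
        rintro _ ⟨w, rfl⟩
        have hx' : Matrix.vecMul x d = 0 := hx
        simp [Matrix.dotProduct_mulVec, hx'])
      refine ⟨φ, Subtype.ext ?_⟩
      ext i
      exact (LinearMap.congr_fun hφ (Pi.single i 1)).trans (by simp)

theorem rightDualEquiv_apply {a b : ℕ} (d : Matrix (Fin b) (Fin a) R)
    (q : (Fin b → R) →ₗ[Rᵐᵒᵖ] N) (hq : Function.Surjective q)
    (hd : LinearMap.ker q = LinearMap.range (colMap d)) (f : RightDual R N) (v : Fin b → R) :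
    f (q v) = (rightDualEquiv d q hq hd f : Fin b → R) ⬝ᵥ v :=
  rightFunctional_apply (f ∘ₗ q) v

/-- The map from the second free module of a resolution of `N` onto the first syzygy of `N`. -/
def RightRes.toSyzygy (P : RightRes R) (p : (Fin (P.rank 0) → R) →ₗ[Rᵐᵒᵖ] N)
    (hker : LinearMap.ker p = LinearMap.range (colMap (P.d 0))) :
    (Fin (P.rank 1) → R) →ₗ[Rᵐᵒᵖ] LinearMap.ker p :=
  (colMap (P.d 0)).codRestrict _ fun v => by rw [hker]; exact ⟨v, rfl⟩

theorem RightRes.toSyzygy_surjective (P : RightRes R) (p : (Fin (P.rank 0) → R) →ₗ[Rᵐᵒᵖ] N)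
    (hker : LinearMap.ker p = LinearMap.range (colMap (P.d 0))) :
    Function.Surjective (P.toSyzygy p hker) := by
  rintro ⟨x, hx⟩
  have hx' := hx
  rw [hker] at hx'
  obtain ⟨v, rfl⟩ := hx'
  exact ⟨v, rfl⟩

theorem RightRes.ker_toSyzygy (P : RightRes R) (p : (Fin (P.rank 0) → R) →ₗ[Rᵐᵒᵖ] N)
    (hker : LinearMap.ker p = LinearMap.range (colMap (P.d 0))) :
    LinearMap.ker (P.toSyzygy p hker) = LinearMap.range (colMap (P.d 1)) :=
  (LinearMap.ker_codRestrict _ _ _).trans (P.ker_eq_range 0)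

/-- `Ext^{n+1}(N, R)` is the cohomology of the dual of a resolution of `N`. -/
theorem exists_cocycles_surjective : ∀ (n : ℕ) (N : Type u) [AddCommGroup N] [Module Rᵐᵒᵖ N]
    (P : RightRes R) (p : (Fin (P.rank 0) → R) →ₗ[Rᵐᵒᵖ] N), Function.Surjective p →
    LinearMap.ker p = LinearMap.range (colMap (P.d 0)) →
    ∃ φ : LinearMap.ker (rowMap (P.d (n + 1))) →ₗ[R] DualExt R N (n + 1),
      Function.Surjective φ ∧ ∀ x, φ x = 0 ↔ (x : _ → R) ∈ LinearMap.range (rowMap (P.d n)) := by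
  intro n
  induction n with
  | zero =>
    intro N _ _ P p hp hker
    let q := P.toSyzygy p hker
    have hq := P.toSyzygy_surjective p hker
    have hqk := P.ker_toSyzygy p hker
    have hs := IsShortExact.ker_subtype hp
    let e := rightDualEquiv (P.d 1) q hq hqk
    refine ⟨connecting hs 0 ∘ₗ (dualExtZeroEquiv.toLinearMap ∘ₗ e.symm.toLinearMap), ?_, ?_⟩
    · exact (connecting_surjective hs 0 (extVanish_of_projective 0)).comp
        (dualExtZeroEquiv.surjective.comp e.symm.surjective)
    · intro x
      obtain ⟨f, rfl⟩ := e.surjective x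
      simp only [LinearMap.comp_apply, LinearEquiv.coe_coe, LinearEquiv.symm_apply_apply]
      rw [connecting_dualExtZeroEquiv_eq_zero_iff]
      constructor
      · rintro ⟨ψ, rfl⟩
        refine ⟨fun i => ψ (Pi.single i 1), ?_⟩
        ext i
        have h1 := rightFunctional_apply ψ ((P.d 0).mulVec (Pi.single i 1))
        rw [Matrix.dotProduct_mulVec] at h1
        simp only [dotProduct_single_one] at h1
        exact h1.symm
      · rintro ⟨y, hy⟩
        refine ⟨ofRow y, ?_⟩
        ext x
        obtain ⟨v, rfl⟩ := hq x
        refine Eq.trans ?_ (rightDualEquiv_apply (P.d 1) q hq hqk f v).symm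
        change y ⬝ᵥ (P.d 0).mulVec v = _
        rw [Matrix.dotProduct_mulVec]
        exact congrArg (fun z => z ⬝ᵥ v) hy
  | succ n ih =>
    intro N _ _ P p hp hker
    let q := P.toSyzygy p hker
    have hq := P.toSyzygy_surjective p hker
    have hqk := P.ker_toSyzygy p hker
    have hs := IsShortExact.ker_subtype hp
    obtain ⟨φ, hφ, hφ0⟩ := ih (LinearMap.ker p) P.shift q hq hqk
    refine ⟨connecting hs (n + 1) ∘ₗ φ,
      (connecting_surjective hs (n + 1) (extVanish_of_projective _)).comp hφ, fun x => ?_⟩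
    have hinj := connecting_injective hs (n + 1) fun e => by
      rw [(extVanish_of_projective n).eq_zero e, Abelian.Ext.comp_zero]
    refine Iff.trans ?_ (hφ0 x)
    exact hinj.eq_iff' (map_zero _)

end DualExt

/-! ### The grade of submodules of `Ext^i(N, R)` -/

section Grade

variable {R : Type u} [Ring R]

/-- `Hom(Ext^i(N, R), I)` is `Tor_i(N, I)` for an injective module `I`, hence vanishes for `i`
above the flat dimension of `I`. -/
theorem linearMap_dualExt_eq_zero [IsNoetherianRing Rᵐᵒᵖ] {N : Type u} [AddCommGroup N]
    [Module Rᵐᵒᵖ N] [Module.Finite Rᵐᵒᵖ N] {I : ModuleCat.{u} R} [Module.Injective R I] {m n : ℕ}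
    (hI : HasFlatDimensionLE R m I) (hmn : m ≤ n) (f : DualExt R N (n + 1) →ₗ[R] I) : f = 0 := by
  obtain ⟨P, p, hp, hker⟩ := exists_rightRes (R := R) N
  obtain ⟨φ, hφ, hφ0⟩ := exists_cocycles_surjective n N P p hp hker
  obtain ⟨G, hG⟩ := Module.Injective.extension_property R I _ _
    (LinearMap.ker (rowMap (P.d (n + 1)))).subtype (Submodule.subtype_injective _) (f ∘ₗ φ)
  obtain ⟨w, hw⟩ := hI.matAct_exact P m I n hmn (fun i => G (Pi.single i 1)) (by
    ext i
    have h1 : Matrix.vecMul (Pi.single i 1) (P.d n) ∈ LinearMap.ker (rowMap (P.d (n + 1))) := by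
      change Matrix.vecMul (Matrix.vecMul (Pi.single i 1) (P.d n)) (P.d (n + 1)) = 0
      rw [Matrix.vecMul_vecMul, P.comp, Matrix.vecMul_zero]
    have h2 := LinearMap.congr_fun hG ⟨_, h1⟩
    rw [LinearMap.comp_apply, LinearMap.comp_apply,
      (hφ0 ⟨_, h1⟩).2 ⟨_, Matrix.vecMulLinear_apply _ _⟩, map_zero] at h2
    refine Eq.trans ?_ h2
    rw [Submodule.subtype_apply, leftLinear_apply G]
    simp [matAct_apply])
  ext e
  obtain ⟨x, rfl⟩ := hφ e
  have h2 := LinearMap.congr_fun hG x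
  rw [LinearMap.comp_apply, LinearMap.comp_apply] at h2
  rw [← h2, Submodule.subtype_apply, leftLinear_apply G]
  have h3 : ∀ i, G (Pi.single i 1) = ∑ l, P.d (n + 1) i l • w l := fun i =>
    (congrFun hw i).symm
  have h4 : Matrix.vecMul (x : _ → R) (P.d (n + 1)) = 0 := x.2
  simp only [h3, Finset.smul_sum, smul_smul]
  rw [Finset.sum_comm]
  refine Finset.sum_eq_zero fun l _ => ?_
  rw [← Finset.sum_smul]
  have h5 := congrFun h4 l
  simp only [Matrix.vecMul, dotProduct, Pi.zero_apply] at h5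
  rw [h5, zero_smul]

/-- If `X` has no nonzero homomorphism to the first `i` terms of an injective resolution of `R`,
then `X` has grade at least `i`. -/
theorem extVanish_of_hom_injective (J : MinimalInjectiveResolution R R) {X : Type u}
    [AddCommGroup X] [Module R X] {i : ℕ} (H : ∀ j < i, ∀ f : X →ₗ[R] J.I j, f = 0) :
    ∀ j < i, ExtVanish R X R j := by
  have hinj := J.injective
  have aux : ∀ j m, m + 1 + j < i → ExtVanish R X (LinearMap.range (J.d m)) j := by
    intro j
    induction j with
    | zero =>
      intro m hm
      refine extVanish_zero_iff.2 fun f => ?_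
      have h1 := H (m + 1) hm ((LinearMap.range (J.d m)).subtype ∘ₗ f)
      ext x
      exact LinearMap.congr_fun h1 x
    | succ j ih =>
      intro m hm
      have hs : IsShortExact (LinearMap.range (J.d m)).subtype (J.d (m + 1)).rangeRestrict := by
        refine ⟨Submodule.subtype_injective _, fun x => ?_, LinearMap.surjective_rangeRestrict _⟩
        rw [← LinearMap.mem_ker, LinearMap.ker_rangeRestrict, LinearMap.mem_ker,
          J.exact_succ m x]
        simp
      exact hs.extVanish_to_first (ih (m + 1) (by omega)) (extVanish_of_injective j)
  intro j hj
  cases j with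
  | zero =>
    refine extVanish_zero_iff.2 fun f => ?_
    have h1 := H 0 hj (J.ι ∘ₗ f)
    ext x
    exact J.ι_injective ((LinearMap.congr_fun h1 x).trans (map_zero _).symm)
  | succ j =>
    have hs : IsShortExact J.ι (J.d 0).rangeRestrict := by
      refine ⟨J.ι_injective, fun x => ?_, LinearMap.surjective_rangeRestrict _⟩
      rw [← LinearMap.mem_ker, LinearMap.ker_rangeRestrict, LinearMap.mem_ker,
        J.exact_zero x]
    exact hs.extVanish_to_first (aux j 0 (by omega)) (extVanish_of_injective j)

/-- Over a `k`-Gorenstein ring, submodules of `Ext^i(N, R)` have grade at least `i` for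
`1 ≤ i ≤ k`. -/
theorem extVanish_of_injective_dualExt [IsNoetherianRing Rᵐᵒᵖ] {k : ℕ} (hR : IsKGorenstein R k)
    {N : Type u} [AddCommGroup N] [Module Rᵐᵒᵖ N] [Module.Finite Rᵐᵒᵖ N] {X : Type u}
    [AddCommGroup X] [Module R X] {n : ℕ} (hn : n < k) (g : X →ₗ[R] DualExt R N (n + 1))
    (hg : Function.Injective g) : ∀ j ≤ n, ExtVanish R X R j := by
  obtain ⟨J, hJ⟩ := hR
  intro j hj
  refine extVanish_of_hom_injective J (i := n + 1) (fun j hj f => ?_) j (by omega)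
  have := J.injective j
  obtain ⟨h, rfl⟩ := Module.Injective.extension_property R (J.I j) _ _ g hg f
  rw [linearMap_dualExt_eq_zero (hJ j (by omega)) (by omega) h, LinearMap.zero_comp]

end Grade

/-! ### The dual of a resolution of a right module -/

section RightRes

variable {R : Type u} [Ring R]

/-- The cokernel of the dual of the `n`-th differential: the transpose of the `n`-th syzygy. -/
abbrev RightRes.transpose (P : RightRes R) (n : ℕ) : Type u :=
  (Fin (P.rank (n + 1)) → R) ⧸ LinearMap.range (rowMap (P.d n))

variable (P : RightRes R) {N : Type u} [AddCommGroup N] [Module Rᵐᵒᵖ N]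

theorem RightRes.rowMap_comp (n : ℕ) :
    LinearMap.range (rowMap (P.d n)) ≤ LinearMap.ker (rowMap (P.d (n + 1))) := by
  rintro _ ⟨x, rfl⟩
  simp [Matrix.vecMul_vecMul, P.comp]

theorem RightRes.ker_rowMap_eq_range {p : (Fin (P.rank 0) → R) →ₗ[Rᵐᵒᵖ] N}
    (hp : Function.Surjective p) (hker : LinearMap.ker p = LinearMap.range (colMap (P.d 0)))
    {n : ℕ} (hN : ExtVanish Rᵐᵒᵖ N R (n + 1)) :
    LinearMap.ker (rowMap (P.d (n + 1))) = LinearMap.range (rowMap (P.d n)) := by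
  obtain ⟨φ, _, hφ⟩ := exists_cocycles_surjective n N P p hp hker
  refine le_antisymm (fun x hx => ?_) (P.rowMap_comp n)
  exact (hφ ⟨x, hx⟩).1 (hN.eq_zero _)

theorem RightRes.rowMap_zero_injective {p : (Fin (P.rank 0) → R) →ₗ[Rᵐᵒᵖ] N}
    (hp : Function.Surjective p) (hker : LinearMap.ker p = LinearMap.range (colMap (P.d 0)))
    (hN : ExtVanish Rᵐᵒᵖ N R 0) : Function.Injective (rowMap (P.d 0)) := by
  rw [← LinearMap.ker_eq_bot, LinearMap.ker_eq_bot']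
  intro x hx
  obtain ⟨f, hf⟩ := (rightDualEquiv (P.d 0) p hp hker).surjective ⟨x, hx⟩
  rw [extVanish_zero_iff.1 hN f, map_zero] at hf
  exact (congrArg Subtype.val hf).symm

/-- `0 → im d_n → R ^ (rank (n + 1)) → im d_{n+1} → 0`, where the cohomology vanishes. -/
theorem RightRes.isShortExact_range {n : ℕ}
    (h : LinearMap.ker (rowMap (P.d (n + 1))) = LinearMap.range (rowMap (P.d n))) :
    IsShortExact (LinearMap.range (rowMap (P.d n))).subtype (rowMap (P.d (n + 1))).rangeRestrict :=
  h ▸ IsShortExact.ker_rangeRestrict (rowMap (P.d (n + 1)))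

/-- A right module whose first nonvanishing `Ext` with values in `R` sits in degree `n` has
`Ext^j(Ext^n(E, R), R) ≠ 0` for some `j ≤ n`: the dual of a resolution of `E` is, up to degree
`n`, a resolution of a module containing `Ext^n(E, R)`. -/
theorem extVanish_of_grade [IsNoetherianRing Rᵐᵒᵖ] (E : Type u) [AddCommGroup E]
    [Module Rᵐᵒᵖ E] [Module.Finite Rᵐᵒᵖ E] (n : ℕ) (hlt : ∀ j < n, ExtVanish Rᵐᵒᵖ E R j)
    (hX : ∀ j ≤ n, ExtVanish R (DualExt R E n) R j) : ExtVanish Rᵐᵒᵖ E R n := by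
  cases n with
  | zero =>
    refine extVanish_zero_iff.2 fun f => LinearMap.ext fun x => ?_
    let ev : RightDual R E →ₗ[R] R :=
      { toFun := fun g => g x, map_add' := fun _ _ => rfl, map_smul' := fun _ _ => rfl }
    have h1 := extVanish_zero_iff.1 (hX 0 le_rfl) (ev ∘ₗ dualExtZeroEquiv.symm.toLinearMap)
    have h2 := LinearMap.congr_fun h1 (dualExtZeroEquiv f)
    simpa [ev] using h2
  | succ n =>
    obtain ⟨P, p, hp, hker⟩ := exists_rightRes (R := R) E
    have hI : ∀ m ≤ n, ∀ j, j + m ≤ n →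
        ExtVanish R (DualExt R E (n + 1)) (LinearMap.range (rowMap (P.d m))) (j + 1) := by
      intro m
      induction m with
      | zero =>
        intro _ j hj
        exact ((hX (j + 1) (by omega)).pi _).of_equiv_right
          (LinearEquiv.ofInjective _ (P.rowMap_zero_injective hp hker (hlt 0 (by omega))))
      | succ m ih =>
        intro hm j hj
        have hs := P.isShortExact_range (P.ker_rowMap_eq_range hp hker (hlt (m + 1) (by omega)))
        exact hs.extVanish_to_third ((hX (j + 1) (by omega)).pi _)
          (ih (by omega) (j + 1) (by omega))
    have htr : ExtVanish R (DualExt R E (n + 1)) (P.transpose n) 0 :=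
      (IsShortExact.subtype_mkQ (LinearMap.range (rowMap (P.d n)))).extVanish_to_third
        ((hX 0 (by omega)).pi _) (hI n le_rfl 0 (by omega))
    obtain ⟨φ, hφ, hφ0⟩ := exists_cocycles_surjective n E P p hp hker
    obtain ⟨χ, hχ⟩ := exists_factor φ hφ
      ((LinearMap.range (rowMap (P.d n))).mkQ ∘ₗ (LinearMap.ker (rowMap (P.d (n + 1)))).subtype)
      (fun x hx => by
        rw [LinearMap.mem_ker, LinearMap.comp_apply, Submodule.mkQ_apply,
          Submodule.Quotient.mk_eq_zero]
        exact (hφ0 x).1 hx)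
    rw [extVanish_zero_iff.1 htr χ, LinearMap.zero_comp] at hχ
    refine .of_forall fun e => ?_
    obtain ⟨x, rfl⟩ := hφ e
    refine (hφ0 x).2 ?_
    have h1 := LinearMap.congr_fun hχ x
    rw [LinearMap.zero_apply, LinearMap.comp_apply, Submodule.mkQ_apply, eq_comm,
      Submodule.Quotient.mk_eq_zero] at h1
    exact h1

/-- If `Ext^1, …, Ext^n` of `N` vanish, the transpose of `N` is an `n`-th syzygy of the transpose
of the `n`-th syzygy of `N`. -/
theorem RightRes.extVanish_transpose_zero {p : (Fin (P.rank 0) → R) →ₗ[Rᵐᵒᵖ] N}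
    (hp : Function.Surjective p) (hker : LinearMap.ker p = LinearMap.range (colMap (P.d 0)))
    {n j : ℕ} (hN : ∀ i < n, ExtVanish Rᵐᵒᵖ N R (i + 1))
    (h : ExtVanish R (P.transpose n) R (j + 1 + n)) : ExtVanish R (P.transpose 0) R (j + 1) := by
  induction n generalizing j with
  | zero => exact h
  | succ n ih =>
    refine ih (fun i hi => hN i (by omega)) ?_
    have h1 : ExtVanish R (LinearMap.range (rowMap (P.d (n + 1)))) R (j + n + 1) :=
      (IsShortExact.subtype_mkQ (LinearMap.range (rowMap (P.d (n + 1))))).extVanish_first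
        (extVanish_of_projective _) (by convert h using 1; omega)
    have e : P.transpose n ≃ₗ[R] LinearMap.range (rowMap (P.d (n + 1))) :=
      (Submodule.quotEquivOfEq _ _ (P.ker_rowMap_eq_range hp hker (hN n (by omega))).symm).trans
        (rowMap (P.d (n + 1))).quotKerEquivRange
    convert h1.of_equiv_left e.symm using 1
    omega

end RightRes

/-! ### The dual of a resolution of a left module -/

section LeftRes

variable {R : Type u} [Ring R] (P : LeftRes R)

/-- The cokernel of the dual of the `n`-th differential: the transpose of the `n`-th syzygy. -/
abbrev LeftRes.transpose (n : ℕ) : Type u :=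
  (Fin (P.rank (n + 1)) → R) ⧸ LinearMap.range (colMap (P.d n))

theorem LeftRes.colMap_comp (n : ℕ) :
    LinearMap.range (colMap (P.d n)) ≤ LinearMap.ker (colMap (P.d (n + 1))) := by
  rintro _ ⟨x, rfl⟩
  simp [Matrix.mulVec_mulVec, P.comp]

/-- The map induced by the dual of the differential on the transpose of the `n`-th syzygy. -/
def LeftRes.transposeMap (n : ℕ) :
    P.transpose n →ₗ[Rᵐᵒᵖ] LinearMap.range (colMap (P.d (n + 1))) :=
  (LinearMap.range (colMap (P.d n))).liftQ (colMap (P.d (n + 1))).rangeRestrict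
    (by rw [LinearMap.ker_rangeRestrict]; exact P.colMap_comp n)

/-- The right module `Ext^{n+1}(M, R)`, for `M` the module resolved by `P`, as the cohomology of
the dual of `P`. -/
abbrev LeftRes.cohomology (n : ℕ) : Submodule Rᵐᵒᵖ (P.transpose n) :=
  LinearMap.ker (P.transposeMap n)

theorem LeftRes.isShortExact_cohomology (n : ℕ) :
    IsShortExact (P.cohomology n).subtype (P.transposeMap n) := by
  refine IsShortExact.ker_subtype fun x => ?_
  obtain ⟨v, rfl⟩ := (colMap (P.d (n + 1))).surjective_rangeRestrict x
  exact ⟨Submodule.Quotient.mk v, rfl⟩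

/-- A right functional whose restriction along `d_n` vanishes comes from `d_{n+1}`. -/
theorem LeftRes.exists_row_of_comp_eq_zero {n : ℕ} (f : (Fin (P.rank (n + 1)) → R) →ₗ[Rᵐᵒᵖ] R)
    (hf : ∀ v, f ((P.d n).mulVec v) = 0) :
    ∃ y : Fin (P.rank (n + 2)) → R, ∀ v, f v = y ⬝ᵥ (P.d (n + 1)).mulVec v := by
  obtain ⟨y, hy⟩ := P.exact n (fun i => f (Pi.single i 1)) (by
    ext j
    have h1 := hf (Pi.single j 1)
    rw [rightFunctional_apply, Matrix.dotProduct_mulVec, dotProduct_single_one] at h1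
    exact h1)
  refine ⟨y, fun v => ?_⟩
  rw [rightFunctional_apply f v, ← hy, Matrix.dotProduct_mulVec]

theorem LeftRes.extVanish_transpose_one (n : ℕ) :
    ExtVanish Rᵐᵒᵖ (P.transpose (n + 1)) R 1 := by
  refine (IsShortExact.subtype_mkQ (LinearMap.range (colMap (P.d (n + 1))))).extVanish_of_extend
    (extVanish_of_projective 0) fun φ => ?_
  obtain ⟨y, hy⟩ := P.exists_row_of_comp_eq_zero (n := n)
    (φ ∘ₗ (colMap (P.d (n + 1))).rangeRestrict) (fun v => by
      have : (colMap (P.d (n + 1))).rangeRestrict ((P.d n).mulVec v) = 0 := by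
        ext1
        simp [Matrix.mulVec_mulVec, P.comp]
      rw [LinearMap.comp_apply, this, map_zero])
  refine ⟨ofRow y, LinearMap.ext fun x => ?_⟩
  obtain ⟨v, rfl⟩ := (colMap (P.d (n + 1))).surjective_rangeRestrict x
  exact (hy v).symm

/-- If each `Ext^{m+1}(M, R)` with `m < n` has grade at least `m + 1`, then the `n`-th syzygy of
`M` is `n`-torsionfree. -/
theorem LeftRes.extVanish_transpose (n : ℕ)
    (H : ∀ m < n, ∀ j ≤ m, ExtVanish Rᵐᵒᵖ (P.cohomology m) R j) :
    ∀ j < n, ExtVanish Rᵐᵒᵖ (P.transpose n) R (j + 1) := by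
  induction n with
  | zero => intro j hj; omega
  | succ n ih =>
    intro j hj
    cases j with
    | zero => exact P.extVanish_transpose_one n
    | succ j =>
      have h1 := (P.isShortExact_cohomology n).extVanish_third (H n (by omega) j (by omega))
        (ih (fun m hm => H m (by omega)) j (by omega))
      exact (IsShortExact.subtype_mkQ _).extVanish_third h1 (extVanish_of_projective _)

/-- The left-right symmetry of the Gorenstein condition: `Ext^{n+1}(M, R)` has grade at least
`n + 1` also for left modules `M`, when `n < k`. -/
theorem LeftRes.extVanish_cohomology [IsNoetherianRing Rᵐᵒᵖ] {k : ℕ} (hR : IsKGorenstein R k) :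
    ∀ n < k, ∀ (P : LeftRes R), ∀ j ≤ n, ExtVanish Rᵐᵒᵖ (P.cohomology n) R j := by
  intro n
  induction n using Nat.strong_induction_on with
  | _ n ih =>
    intro hn P
    have hlt : ∀ j < n, ExtVanish Rᵐᵒᵖ (P.cohomology n) R j := by
      intro j hj
      obtain ⟨m, rfl⟩ : ∃ m, n = m + 1 := ⟨n - 1, by omega⟩
      exact ih m (by omega) (by omega) P.shift j (by omega)
    have heq : ExtVanish Rᵐᵒᵖ (P.cohomology n) R n := by
      refine extVanish_of_grade (P.cohomology n) n hlt ?_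
      have hs := P.isShortExact_cohomology n
      refine extVanish_of_injective_dualExt hR hn (connecting hs n)
        (connecting_injective hs n fun e => ?_)
      cases n with
      | zero =>
        obtain ⟨ψ, rfl⟩ := (Abelian.Ext.mk₀_bijective _ _).surjective e
        rw [Abelian.Ext.mk₀_comp_mk₀, Abelian.Ext.mk₀_eq_zero_iff]
        refine ModuleCat.hom_ext (LinearMap.ext fun x => ?_)
        obtain ⟨x, hx⟩ := x
        obtain ⟨v, rfl⟩ := Submodule.Quotient.mk_surjective _ x
        obtain ⟨y, hy⟩ := P.exists_row_of_comp_eq_zero (n := 0)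
          (ψ.hom ∘ₗ (LinearMap.range (colMap (P.d 0))).mkQ) (fun v => by
            have h0 : (Submodule.Quotient.mk ((P.d 0).mulVec v) : P.transpose 0) = 0 :=
              (Submodule.Quotient.mk_eq_zero _).2 ⟨v, rfl⟩
            exact (congrArg ψ.hom h0).trans (map_zero _))
        have hv : (P.d 1).mulVec v = 0 := congrArg Subtype.val hx
        refine (hy v).trans ?_
        rw [hv, dotProduct_zero]
        rfl
      | succ n =>
        rw [(P.extVanish_transpose (n + 1) (fun m hm => ih m hm (by omega) P) n
          (by omega)).eq_zero e, Abelian.Ext.comp_zero]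
    intro j hj
    rcases hj.lt_or_eq with h | rfl
    · exact hlt j h
    · exact heq

/-- If functionals on the `(n + 1)`-st syzygy extend to the free module containing it, then
`Ext^{n+1}(M, R) = 0`. -/
theorem LeftRes.extVanish_of_extend : ∀ (n : ℕ) (P : LeftRes R) (M : Type u) [AddCommGroup M]
    [Module R M] (p : (Fin (P.rank 0) → R) →ₗ[R] M), Function.Surjective p →
    LinearMap.ker p = LinearMap.range (rowMap (P.d 0)) →
    (∀ f : LinearMap.range (rowMap (P.d n)) →ₗ[R] R, ∃ g : (Fin (P.rank n) → R) →ₗ[R] R,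
      g ∘ₗ (LinearMap.range (rowMap (P.d n))).subtype = f) → ExtVanish R M R (n + 1) := by
  intro n
  induction n with
  | zero =>
    intro P M _ _ p hp hker H
    refine IsShortExact.extVanish_of_extend (f := (LinearMap.range (rowMap (P.d 0))).subtype)
      (g := p) ?_ (extVanish_of_projective 0) H
    rw [← hker]
    exact IsShortExact.ker_subtype hp
  | succ n ih =>
    intro P M _ _ p hp hker H
    refine (IsShortExact.ker_subtype hp).extVanish_third ?_ (extVanish_of_projective _)
    let q : (Fin (P.rank 1) → R) →ₗ[R] LinearMap.ker p :=
      (rowMap (P.d 0)).codRestrict _ fun v => by rw [hker]; exact ⟨v, rfl⟩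
    refine ih P.shift (LinearMap.ker p) q ?_ ?_ H
    · rintro ⟨x, hx⟩
      rw [hker] at hx
      obtain ⟨v, rfl⟩ := hx
      exact ⟨v, rfl⟩
    · exact (LinearMap.ker_codRestrict _ _ _).trans (P.ker_eq_range 0)

theorem LeftRes.extend_of_exact (n : ℕ)
    (H : ∀ v, (P.d (n + 1)).mulVec v = 0 → ∃ w, (P.d n).mulVec w = v)
    (f : LinearMap.range (rowMap (P.d n)) →ₗ[R] R) :
    ∃ g : (Fin (P.rank n) → R) →ₗ[R] R,
      g ∘ₗ (LinearMap.range (rowMap (P.d n))).subtype = f := by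
  let f' := f ∘ₗ (rowMap (P.d n)).rangeRestrict
  obtain ⟨w, hw⟩ := H (fun i => f' (Pi.single i 1)) (by
    ext j
    have h1 := leftFunctional_apply f' (Matrix.vecMul (Pi.single j 1) (P.d (n + 1)))
    have h2 : (rowMap (P.d n)).rangeRestrict (Matrix.vecMul (Pi.single j 1) (P.d (n + 1))) = 0 := by
      ext1
      change Matrix.vecMul (Matrix.vecMul (Pi.single j 1) (P.d (n + 1))) (P.d n) = 0
      rw [Matrix.vecMul_vecMul, P.comp, Matrix.vecMul_zero]
    rw [← Matrix.dotProduct_mulVec, single_one_dotProduct] at h1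
    rw [← h1, LinearMap.comp_apply, h2, map_zero]
    rfl)
  refine ⟨ofCol w, LinearMap.ext fun x => ?_⟩
  obtain ⟨y, rfl⟩ := (rowMap (P.d n)).surjective_rangeRestrict x
  have h1 := leftFunctional_apply f' y
  rw [← hw, Matrix.dotProduct_mulVec] at h1
  exact h1.symm

theorem LeftRes.exact_of_subsingleton_cohomology {n : ℕ} [Subsingleton (P.cohomology n)] :
    ∀ v, (P.d (n + 1)).mulVec v = 0 → ∃ w, (P.d n).mulVec w = v := by
  intro v hv
  have h1 : (Submodule.Quotient.mk v : P.transpose n) ∈ P.cohomology n := by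
    rw [LinearMap.mem_ker]
    exact Subtype.ext hv
  have h2 : (⟨_, h1⟩ : P.cohomology n) = 0 := Subsingleton.elim _ _
  exact (Submodule.Quotient.mk_eq_zero _).1 (congrArg Subtype.val h2)

end LeftRes

/-! ### Injective and projective dimension -/

section Dimension

variable {R : Type u} [Ring R]

theorem IsShortExact.hasInjectiveDimensionLT_third {X Y Z : Type u} [AddCommGroup X] [Module R X]
    [AddCommGroup Y] [Module R Y] [AddCommGroup Z] [Module R Z] {f : X →ₗ[R] Y} {g : Y →ₗ[R] Z}
    (h : IsShortExact f g) (hY : Module.Injective R Y) {n : ℕ}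
    (hX : HasInjectiveDimensionLT (ModuleCat.of R X) (n + 2)) :
    HasInjectiveDimensionLT (ModuleCat.of R Z) (n + 1) :=
  (h.shortExact.hasInjectiveDimensionLT_X₃_iff n
    ((Module.injective_iff_injective_object R Y).1 hY)).2 hX

theorem IsShortExact.hasInjectiveDimensionLT_first {X Y Z : Type u} [AddCommGroup X] [Module R X]
    [AddCommGroup Y] [Module R Y] [AddCommGroup Z] [Module R Z] {f : X →ₗ[R] Y} {g : Y →ₗ[R] Z}
    (h : IsShortExact f g) (hY : Module.Injective R Y) {n : ℕ}
    (hZ : HasInjectiveDimensionLT (ModuleCat.of R Z) (n + 1)) :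
    HasInjectiveDimensionLT (ModuleCat.of R X) (n + 2) :=
  (h.shortExact.hasInjectiveDimensionLT_X₃_iff n
    ((Module.injective_iff_injective_object R Y).1 hY)).1 hZ

theorem hasInjectiveDimensionLT_one_iff (X : Type u) [AddCommGroup X] [Module R X] :
    HasInjectiveDimensionLT (ModuleCat.of R X) 1 ↔ Module.Injective R X := by
  rw [Module.injective_iff_injective_object, injective_iff_hasInjectiveDimensionLT_one]

theorem hasProjectiveDimensionLT_one_iff (X : Type u) [AddCommGroup X] [Module R X] :
    HasProjectiveDimensionLT (ModuleCat.of R X) 1 ↔ Module.Projective R X := by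
  rw [IsProjective.iff_projective (R := R), projective_iff_hasProjectiveDimensionLT_one]

theorem exists_injective_embedding (X : Type u) [AddCommGroup X] [Module R X] :
    ∃ (I : ModuleCat.{u} R) (f : X →ₗ[R] I), Module.Injective R I ∧ Function.Injective f := by
  obtain ⟨⟨J, hJ, f, hf⟩⟩ := EnoughInjectives.presentation (ModuleCat.of R X)
  exact ⟨J, f.hom, Module.injective_module_of_injective_object R J,
    (ModuleCat.mono_iff_injective f).1 hf⟩

theorem HasInjectiveDimensionLT.extVanish {X : Type u} [AddCommGroup X] [Module R X] {n : ℕ}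
    (h : HasInjectiveDimensionLT (ModuleCat.of R X) n) (M : Type u) [AddCommGroup M] [Module R M]
    {m : ℕ} (hm : n ≤ m) : ExtVanish R M X m :=
  HasInjectiveDimensionLT.subsingleton (ModuleCat.of R X) n m hm (ModuleCat.of R M)

theorem HasProjectiveDimensionLT.extVanish {M : Type u} [AddCommGroup M] [Module R M] {n : ℕ}
    (h : HasProjectiveDimensionLT (ModuleCat.of R M) n) (X : Type u) [AddCommGroup X] [Module R X]
    {m : ℕ} (hm : n ≤ m) : ExtVanish R M X m :=
  HasProjectiveDimensionLT.subsingleton (ModuleCat.of R M) n m hm (ModuleCat.of R X)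

/-- Baer's criterion for the injective dimension. -/
theorem hasInjectiveDimensionLT_of_ideals (n : ℕ) (X : Type u) [AddCommGroup X] [Module R X]
    (h : ∀ I : Ideal R, ExtVanish R (R ⧸ I) X (n + 1)) :
    HasInjectiveDimensionLT (ModuleCat.of R X) (n + 1) := by
  induction n generalizing X with
  | zero =>
    rw [hasInjectiveDimensionLT_one_iff]
    refine Module.Baer.injective fun I g => ?_
    obtain ⟨ψ, hψ⟩ := (IsShortExact.subtype_mkQ I).extend_of_extVanish (h I) g
    exact ⟨ψ, fun x hx => LinearMap.congr_fun hψ ⟨x, hx⟩⟩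
  | succ n ih =>
    obtain ⟨J, f, hJ, hf⟩ := exists_injective_embedding (R := R) X
    have hs : IsShortExact f (LinearMap.range f).mkQ :=
      ⟨hf, f.exact_map_mkQ_range, Submodule.mkQ_surjective _⟩
    exact hs.hasInjectiveDimensionLT_first hJ (ih _ fun I =>
      hs.extVanish_to_third (extVanish_of_injective n) (h I))

/-- Over a left Noetherian ring, direct sums of copies of an injective module are injective. -/
theorem injective_finsupp [IsNoetherianRing R] (ι : Type u) (X : Type u) [AddCommGroup X]
    [Module R X] [Module.Injective R X] : Module.Injective R (ι →₀ X) := by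
  classical
  refine Module.Baer.injective fun I g => ?_
  -- `g` takes values in the finite direct sum over the supports of generators of its image.
  obtain ⟨t, ht⟩ := (Module.Finite.iff_fg.1 (inferInstance : Module.Finite R (LinearMap.range g)))
  let s : Finset ι := t.biUnion Finsupp.support
  have hs : ∀ x i, i ∉ s → g x i = 0 := by
    have h1 : LinearMap.range g ≤ Finsupp.supported X R (s : Set ι) := by
      rw [← ht, Submodule.span_le]
      intro y hy i hi
      exact Finset.mem_biUnion.2 ⟨y, hy, hi⟩
    intro x i hi
    exact (Finsupp.mem_supported' R _).1 (h1 ⟨x, rfl⟩) i hi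
  choose G hG using fun i => Module.Injective.extension_property R X I R I.subtype
    I.subtype_injective (Finsupp.lapply i ∘ₗ g)
  refine ⟨∑ i ∈ s, Finsupp.lsingle i ∘ₗ G i, fun x hx => ?_⟩
  have h2 : ∀ i, G i x = g ⟨x, hx⟩ i := fun i => LinearMap.congr_fun (hG i) ⟨x, hx⟩
  ext j
  simp only [LinearMap.sum_apply, LinearMap.comp_apply, Finsupp.lsingle_apply, h2,
    Finsupp.finsetSum_apply, Finsupp.single_apply]
  rw [Finset.sum_ite_eq']
  split_ifs with h
  · rfl
  · exact (hs _ j h).symm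

theorem hasInjectiveDimensionLT_finsupp [IsNoetherianRing R] (ι : Type u) (n : ℕ) (X : Type u)
    [AddCommGroup X] [Module R X] (hX : HasInjectiveDimensionLT (ModuleCat.of R X) n) :
    HasInjectiveDimensionLT (ModuleCat.of R (ι →₀ X)) n := by
  induction n generalizing X with
  | zero =>
    rw [hasInjectiveDimensionLT_zero_iff_isZero, ModuleCat.isZero_of_iff_subsingleton] at hX ⊢
    exact (inferInstance : Subsingleton (ι →₀ X))
  | succ n ih =>
    cases n with
    | zero =>
      rw [hasInjectiveDimensionLT_one_iff] at hX ⊢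
      exact injective_finsupp ι X
    | succ n =>
      obtain ⟨J, f, hJ, hf⟩ := exists_injective_embedding (R := R) X
      have hs : IsShortExact f (LinearMap.range f).mkQ :=
        ⟨hf, f.exact_map_mkQ_range, Submodule.mkQ_surjective _⟩
      have hs' : IsShortExact (Finsupp.mapRange.linearMap (α := ι) f)
          (Finsupp.mapRange.linearMap (LinearMap.range f).mkQ) := by
        refine ⟨Finsupp.mapRange_injective f (map_zero f) hf, fun y => ⟨fun hy => ?_, ?_⟩,
          Finsupp.mapRange_surjective _ (map_zero _) (Submodule.mkQ_surjective _)⟩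
        · have h0 : Function.invFun f 0 = 0 := by
            rw [← map_zero f]; exact Function.leftInverse_invFun hf 0
          refine ⟨y.mapRange (Function.invFun f) h0, Finsupp.ext fun i => ?_⟩
          have h1 : (LinearMap.range f).mkQ (y i) = 0 := DFunLike.congr_fun hy i
          obtain ⟨x, hx⟩ := (hs.exact (y i)).1 h1
          simp only [Finsupp.mapRange.linearMap_apply, Finsupp.mapRange_apply]
          exact Function.invFun_eq ⟨x, hx⟩
        · rintro ⟨x, rfl⟩
          ext i
          exact (hs.exact _).2 ⟨x i, rfl⟩
      exact hs'.hasInjectiveDimensionLT_first (injective_finsupp ι J)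
        (ih _ (hs.hasInjectiveDimensionLT_third hJ hX))

/-- Finite projective dimensions are bounded by the self-injective dimension. -/
theorem hasProjectiveDimensionLT_of_injectiveDimension [IsNoetherianRing R] {n : ℕ}
    (hR : HasInjectiveDimensionLT (ModuleCat.of R R) n) (M : ModuleCat.{u} R) (m : ℕ)
    (hM : HasProjectiveDimensionLT M m) : HasProjectiveDimensionLT M n := by
  induction m with
  | zero => exact hasProjectiveDimensionLT_of_ge M 0 n (by omega)
  | succ m ih =>
    by_cases hmn : m + 1 ≤ n
    · exact hasProjectiveDimensionLT_of_ge M (m + 1) n hmn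
    refine ih (hasProjectiveDimensionLT_of_enoughInjectives M m fun Y => ?_)
    have hs : IsShortExact _ (Finsupp.linearCombination R (id : Y → Y)) :=
      IsShortExact.ker_subtype (Finsupp.linearCombination_id_surjective R Y)
    exact hs.extVanish_to_third
      (HasInjectiveDimensionLT.extVanish (hasInjectiveDimensionLT_finsupp Y n R hR) M (by omega))
      (HasProjectiveDimensionLT.extVanish hM _ le_rfl)

theorem lt_top_projectiveDimension_iff (M : ModuleCat.{u} R) :
    projectiveDimension M < ⊤ ↔ ∃ m, HasProjectiveDimensionLT M m := by
  rw [lt_top_iff_ne_top, projectiveDimension_ne_top_iff]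
  exact ⟨fun ⟨n, h⟩ => ⟨n + 1, h⟩, fun ⟨n, h⟩ => ⟨n, hasProjectiveDimensionLT_of_ge M n _ (by omega)⟩⟩

theorem bigFinDim_le_iff (k : ℕ) : bigFinDim R ≤ (k : WithBot ℕ∞) ↔
    ∀ (M : ModuleCat.{u} R) (m : ℕ), HasProjectiveDimensionLT M m →
      HasProjectiveDimensionLT M (k + 1) := by
  simp only [bigFinDim, iSup_le_iff, lt_top_projectiveDimension_iff, projectiveDimension_le_iff,
    forall_exists_index]

theorem smallFinDim_le_iff (k : ℕ) : smallFinDim R ≤ (k : WithBot ℕ∞) ↔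
    ∀ (M : ModuleCat.{u} R), Module.Finite R M → ∀ m : ℕ, HasProjectiveDimensionLT M m →
      HasProjectiveDimensionLT M (k + 1) := by
  simp only [smallFinDim, iSup_le_iff, lt_top_projectiveDimension_iff, projectiveDimension_le_iff,
    forall_exists_index]

theorem smallFinDim_lt_of_injectiveDimension_lt [IsNoetherianRing R] {k : ℕ}
    (hR : HasInjectiveDimensionLT (ModuleCat.of R R) k) : smallFinDim R < (k : WithBot ℕ∞) := by
  cases k with
  | zero =>
    have : smallFinDim R ≤ ⊥ := by
      simp only [smallFinDim, iSup_le_iff, lt_top_projectiveDimension_iff]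
      rintro M _ ⟨m, hm⟩
      have := hasProjectiveDimensionLT_of_injectiveDimension hR M m hm
      rw [le_bot_iff, projectiveDimension_eq_bot_iff]
      exact isZero_of_hasProjectiveDimensionLT_zero M
    rw [le_bot_iff.1 this]
    exact WithBot.bot_lt_coe _
  | succ k =>
    have : smallFinDim R ≤ (k : WithBot ℕ∞) := (smallFinDim_le_iff k).2 fun M _ m hm =>
      hasProjectiveDimensionLT_of_injectiveDimension hR M m hm
    refine this.trans_lt ?_
    exact_mod_cast Nat.lt_succ_self k

end Dimension

/-! ### Reflexivity and the vanishing of `Ext` of the transpose -/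

section Reflexive

variable {R : Type u} [Ring R] {N : Type u} [AddCommGroup N] [Module Rᵐᵒᵖ N]

@[simp] theorem evalRight_apply (x : N) (f : RightDual R N) : evalRight R N x f = f x := rfl

theorem subsingleton_of_isTorsionless (h : IsTorsionless R N)
    (h0 : ∀ f : RightDual R N, f = 0) : Subsingleton N :=
  ⟨fun x y => h (LinearMap.ext fun f => by simp [h0 f])⟩

theorem RightRes.isTorsionless (P : RightRes R) {p : (Fin (P.rank 0) → R) →ₗ[Rᵐᵒᵖ] N}
    (hp : Function.Surjective p) (hker : LinearMap.ker p = LinearMap.range (colMap (P.d 0)))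
    (h : ExtVanish R (P.transpose 0) R 1) : IsTorsionless R N := by
  refine (injective_iff_map_eq_zero _).2 fun x hx => ?_
  obtain ⟨v, rfl⟩ := hp x
  -- Pairing with `v` kills `ker (rowMap d_0)`, hence is a functional on the image of `d_0`.
  obtain ⟨φ, hφ⟩ := exists_factor (rowMap (P.d 0)).rangeRestrict
    (rowMap (P.d 0)).surjective_rangeRestrict (ofCol v) (fun y hy => by
      rw [LinearMap.ker_rangeRestrict] at hy
      have h1 := rightDualEquiv_apply (P.d 0) p hp hker
        ((rightDualEquiv (P.d 0) p hp hker).symm ⟨y, hy⟩) v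
      rw [LinearEquiv.apply_symm_apply] at h1
      exact h1.symm.trans (LinearMap.congr_fun hx _))
  obtain ⟨ψ, hψ⟩ := (IsShortExact.subtype_mkQ _).extend_of_extVanish h φ
  rw [← LinearMap.mem_ker, hker]
  refine ⟨fun i => ψ (Pi.single i 1), ?_⟩
  ext i
  have h2 := LinearMap.congr_fun hφ (Pi.single i 1)
  rw [← hψ] at h2
  have h3 := leftFunctional_apply ψ (Matrix.vecMul (Pi.single i 1) (P.d 0))
  rw [← Matrix.dotProduct_mulVec, single_one_dotProduct] at h3
  refine h3.symm.trans (h2.trans ?_)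
  simp

theorem RightRes.evalRight_surjective (P : RightRes R) {p : (Fin (P.rank 0) → R) →ₗ[Rᵐᵒᵖ] N}
    (hp : Function.Surjective p) (hker : LinearMap.ker p = LinearMap.range (colMap (P.d 0)))
    (h : ExtVanish R (P.transpose 0) R 2) : Function.Surjective (evalRight R N) := by
  intro g
  have h1 : ExtVanish R (LinearMap.range (rowMap (P.d 0))) R 1 :=
    (IsShortExact.subtype_mkQ (LinearMap.range (rowMap (P.d 0)))).extVanish_first
      (extVanish_of_projective 0) h
  have hs := IsShortExact.ker_rangeRestrict (rowMap (P.d 0))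
  let e := rightDualEquiv (P.d 0) p hp hker
  obtain ⟨ψ, hψ⟩ := hs.extend_of_extVanish h1 (g ∘ₗ e.symm.toLinearMap)
  refine ⟨p fun i => ψ (Pi.single i 1), LinearMap.ext fun f => ?_⟩
  have h2 := LinearMap.congr_fun hψ (e f)
  simp only [LinearMap.comp_apply, LinearEquiv.coe_coe, LinearEquiv.symm_apply_apply] at h2
  rw [evalRight_apply, rightDualEquiv_apply (P.d 0) p hp hker, ← h2]
  exact (leftFunctional_apply ψ _).symm

/-- If `id R ≤ k`, right modules of reduced grade at least `k + 1` are reflexive. -/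
theorem isReflexive_of_reducedGrade [IsNoetherianRing Rᵐᵒᵖ] [Module.Finite Rᵐᵒᵖ N] {k : ℕ}
    (hR : HasInjectiveDimensionLT (ModuleCat.of R R) (k + 1))
    (hN : ∀ i < k, ExtVanish Rᵐᵒᵖ N R (i + 1)) : IsReflexive R N := by
  obtain ⟨P, p, hp, hker⟩ := exists_rightRes (R := R) N
  exact ⟨P.isTorsionless hp hker (P.extVanish_transpose_zero hp hker (j := 0) hN
      (HasInjectiveDimensionLT.extVanish hR _ (by omega))),
    P.evalRight_surjective hp hker (P.extVanish_transpose_zero hp hker (j := 1) hN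
      (HasInjectiveDimensionLT.extVanish hR _ (by omega)))⟩

end Reflexive

/-! ### Bounding the self-injective dimension -/

section SelfInjective

variable {R : Type u} [Ring R]

theorem hasInjectiveDimensionLT_of_cohomology [IsNoetherianRing R] {k : ℕ}
    (h : ∀ P : LeftRes R, Subsingleton (P.cohomology k)) :
    HasInjectiveDimensionLT (ModuleCat.of R R) (k + 1) := by
  refine hasInjectiveDimensionLT_of_ideals k R fun I => ?_
  obtain ⟨P, p, hp, hker⟩ := exists_leftRes (R := R) (R ⧸ I)
  have := h P
  exact LeftRes.extVanish_of_extend k P _ p hp hker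
    (P.extend_of_exact k P.exact_of_subsingleton_cohomology)

/-- If `fin.dim R ≤ k`, right modules of grade greater than `k` vanish: such a module `E` is
`Ext^{k+1}(W, R)` for a module `W` of projective dimension at most `k + 1`, resolved by the dual of
a resolution of `E`. -/
theorem subsingleton_of_grade [IsNoetherianRing Rᵐᵒᵖ] {k : ℕ}
    (hR : ∀ M : ModuleCat.{u} R, Module.Finite R M → ∀ m, HasProjectiveDimensionLT M m →
      HasProjectiveDimensionLT M (k + 1))
    (E : Type u) [AddCommGroup E] [Module Rᵐᵒᵖ E] [Module.Finite Rᵐᵒᵖ E]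
    (hE : ∀ j ≤ k, ExtVanish Rᵐᵒᵖ E R j) : Subsingleton E := by
  obtain ⟨P, p, hp, hker⟩ := exists_rightRes (R := R) E
  have hinj := P.rowMap_zero_injective hp hker (hE 0 (by omega))
  have hfree : ∀ n m, HasProjectiveDimensionLT (ModuleCat.of R (Fin n → R)) (m + 1) := fun n m =>
    haveI := (hasProjectiveDimensionLT_one_iff (R := R) (Fin n → R)).2 inferInstance
    hasProjectiveDimensionLT_of_ge _ 1 _ (by omega)
  have hI : ∀ m ≤ k,
      HasProjectiveDimensionLT (ModuleCat.of R (LinearMap.range (rowMap (P.d m)))) (m + 1) := by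
    intro m
    induction m with
    | zero =>
      intro _
      rw [hasProjectiveDimensionLT_one_iff]
      exact .of_equiv (LinearEquiv.ofInjective _ hinj)
    | succ m ih =>
      intro hm
      have hs := P.isShortExact_range (P.ker_rowMap_eq_range hp hker (hE (m + 1) hm))
      exact hs.shortExact.hasProjectiveDimensionLT_X₃ (m + 1) (ih (by omega)) (hfree _ _)
  have htr : HasProjectiveDimensionLT (ModuleCat.of R (P.transpose k)) (k + 2) :=
    (IsShortExact.subtype_mkQ (LinearMap.range
      (rowMap (P.d k)))).shortExact.hasProjectiveDimensionLT_X₃ (k + 1) (hI k le_rfl) (hfree _ _)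
  have htr' := hR (ModuleCat.of R (P.transpose k)) (inferInstanceAs (Module.Finite R _)) _ htr
  have h1 : ExtVanish R (P.transpose 0) R 1 :=
    P.extVanish_transpose_zero hp hker (n := k) (j := 0) (fun i hi => hE (i + 1) (by omega))
      (HasProjectiveDimensionLT.extVanish htr' R (by omega))
  have h2 : ∀ i, Pi.single i 1 ∈ LinearMap.ker p := by
    intro i
    obtain ⟨ψ, hψ⟩ := (IsShortExact.subtype_mkQ _).extend_of_extVanish h1
      ((LinearMap.proj i : (Fin (P.rank 0) → R) →ₗ[R] R) ∘ₗ
        (LinearEquiv.ofInjective _ hinj).symm.toLinearMap)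
    rw [hker]
    refine ⟨fun l => ψ (Pi.single l 1), ?_⟩
    ext j
    have h3 := leftFunctional_apply ψ (rowMap (P.d 0) (Pi.single j 1))
    have h4 := LinearMap.congr_fun hψ (LinearEquiv.ofInjective _ hinj (Pi.single j 1))
    simp only [LinearMap.comp_apply, LinearEquiv.coe_coe, LinearEquiv.symm_apply_apply] at h4
    rw [Matrix.vecMulLinear_apply, ← Matrix.dotProduct_mulVec, single_one_dotProduct] at h3
    refine h3.symm.trans (h4.trans ?_)
    simp [Pi.single_apply, eq_comm]
  refine subsingleton_of_forall_eq 0 fun x => ?_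
  obtain ⟨v, rfl⟩ := hp x
  rw [rightLinear_apply p v]
  exact Finset.sum_eq_zero fun i _ => by rw [LinearMap.mem_ker.1 (h2 i), smul_zero]

end SelfInjective

/-! ### Duals of finitely generated projective modules -/

section ProjectiveDual

variable {R : Type u} [Ring R]

/-- The dual of a homomorphism of right modules. -/
def RightDual.map {N N' : Type u} [AddCommGroup N] [Module Rᵐᵒᵖ N] [AddCommGroup N']
    [Module Rᵐᵒᵖ N'] (π : N →ₗ[Rᵐᵒᵖ] N') : RightDual R N' →ₗ[R] RightDual R N where
  toFun f := f.comp π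
  map_add' _ _ := rfl
  map_smul' _ _ := rfl

/-- Functionals on the free left module of row vectors are column vectors. -/
def leftDualFreeEquiv (R : Type u) [Ring R] (n : ℕ) :
    LeftDual R (Fin n → R) ≃ₗ[Rᵐᵒᵖ] (Fin n → R) where
  toFun φ i := φ (Pi.single i 1)
  map_add' _ _ := rfl
  map_smul' _ _ := rfl
  invFun v := ofCol v
  left_inv φ := LinearMap.ext fun x => (leftFunctional_apply φ x).symm
  right_inv v := by ext i; simp

theorem finite_leftDual [IsNoetherianRing Rᵐᵒᵖ] (Y : Type u) [AddCommGroup Y] [Module R Y]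
    [Module.Finite R Y] : Module.Finite Rᵐᵒᵖ (LeftDual R Y) := by
  obtain ⟨n, p, hp⟩ := Module.Finite.exists_fin' R Y
  refine Module.Finite.of_injective
    ((leftDualFreeEquiv R n).toLinearMap ∘ₗ LeftDual.map p) ?_
  have hinj : Function.Injective (LeftDual.map p) := by
    intro f g hfg
    ext y
    obtain ⟨x, rfl⟩ := hp y
    exact LinearMap.congr_fun hfg x
  exact (leftDualFreeEquiv R n).injective.comp hinj

theorem projective_leftDual (Y : Type u) [AddCommGroup Y] [Module R Y] [Module.Finite R Y]
    [Module.Projective R Y] : Module.Projective Rᵐᵒᵖ (LeftDual R Y) := by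
  obtain ⟨n, p, hp⟩ := Module.Finite.exists_fin' R Y
  obtain ⟨s, hs⟩ := Module.projective_lifting_property p LinearMap.id hp
  refine Module.Projective.of_split ((leftDualFreeEquiv R n).toLinearMap ∘ₗ LeftDual.map p)
    (LeftDual.map s ∘ₗ (leftDualFreeEquiv R n).symm.toLinearMap) (LinearMap.ext fun f => ?_)
  simp only [LinearMap.comp_apply, LinearEquiv.coe_coe, LinearEquiv.symm_apply_apply]
  exact LinearMap.ext fun y => congrArg f (LinearMap.congr_fun hs y)

theorem finite_rightDual [IsNoetherianRing R] [IsNoetherianRing Rᵐᵒᵖ] (N : Type u)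
    [AddCommGroup N] [Module Rᵐᵒᵖ N] [Module.Finite Rᵐᵒᵖ N] :
    Module.Finite R (RightDual R N) := by
  obtain ⟨P, p, hp, hker⟩ := exists_rightRes (R := R) N
  exact Module.Finite.equiv (rightDualEquiv (P.d 0) p hp hker).symm

variable (N : Type u) [AddCommGroup N] [Module Rᵐᵒᵖ N] [Module.Finite Rᵐᵒᵖ N]
  [Module.Projective Rᵐᵒᵖ N]

theorem exists_col_retract : ∃ (n : ℕ) (s : N →ₗ[Rᵐᵒᵖ] (Fin n → R))
    (p : (Fin n → R) →ₗ[Rᵐᵒᵖ] N), ∀ x, p (s x) = x := by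
  obtain ⟨n, p, hp⟩ := exists_col_surjective (R := R) N
  obtain ⟨s, hs⟩ := Module.projective_lifting_property p LinearMap.id hp
  exact ⟨n, s, p, LinearMap.congr_fun hs⟩

theorem isReflexive_of_projective : IsReflexive R N := by
  obtain ⟨n, s, p, hps⟩ := exists_col_retract (R := R) N
  refine ⟨(injective_iff_map_eq_zero _).2 fun x hx => ?_, fun g => ?_⟩
  · have : s x = 0 := by
      ext i
      exact LinearMap.congr_fun hx
        ((LinearMap.proj i : (Fin n → R) →ₗ[Rᵐᵒᵖ] R) ∘ₗ s)
    rw [← hps x, this, map_zero]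
  · refine ⟨p fun i => g ((LinearMap.proj i : (Fin n → R) →ₗ[Rᵐᵒᵖ] R) ∘ₗ s),
      LinearMap.ext fun f => ?_⟩
    have h1 : f = ∑ i, f (p (Pi.single i 1)) •
        ((LinearMap.proj i : (Fin n → R) →ₗ[Rᵐᵒᵖ] R) ∘ₗ s) := by
      ext x
      conv_lhs => rw [← hps x]
      refine (rightFunctional_apply (f ∘ₗ p) (s x)).trans ?_
      simp [dotProduct, LinearMap.sum_apply]
    rw [evalRight_apply]
    refine (rightFunctional_apply (f ∘ₗ p) _).trans ?_
    conv_rhs => rw [h1]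
    simp [dotProduct, map_sum]

theorem projective_rightDual : Module.Projective R (RightDual R N) := by
  obtain ⟨n, s, p, hps⟩ := exists_col_retract (R := R) N
  let i : RightDual R N →ₗ[R] (Fin n → R) :=
    { toFun := fun f j => f (p (Pi.single j 1))
      map_add' := fun _ _ => rfl
      map_smul' := fun _ _ => rfl }
  let r : (Fin n → R) →ₗ[R] RightDual R N :=
    { toFun := fun y => (ofRow y).comp s
      map_add' := fun y z => LinearMap.ext fun x => add_dotProduct y z (s x)
      map_smul' := fun a y => LinearMap.ext fun x => smul_dotProduct a y (s x) }
  refine Module.Projective.of_split i r (LinearMap.ext fun f => LinearMap.ext fun x => ?_)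
  refine ((rightFunctional_apply (f ∘ₗ p) (s x)).symm).trans ?_
  rw [LinearMap.comp_apply, hps]
  rfl

end ProjectiveDual

/-! ### `D`-classes and syzygies -/

section DClass

variable {R : Type u} [Ring R]

/-- If `0 → T^{**} → Y^* → N → 0` is a double dual embedding with `Y^*` projective, then
`0 → N^* → Y^{**} → T^* → 0` is exact. -/
theorem exists_isShortExact_rightDual [IsNoetherianRing Rᵐᵒᵖ] {T N Y : Type u} [AddCommGroup T]
    [Module Rᵐᵒᵖ T] [AddCommGroup N] [Module Rᵐᵒᵖ N] [AddCommGroup Y] [Module R Y]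
    [Module.Finite R Y] [Module.Projective Rᵐᵒᵖ (LeftDual R Y)] (ρ : Y →ₗ[R] RightDual R T)
    (π : LeftDual R Y →ₗ[Rᵐᵒᵖ] N) (hρ : Function.Surjective ρ)
    (hex : Function.Exact (LeftDual.map ρ) π) (hπ : Function.Surjective π) :
    ∃ q : RightDual R (LeftDual R Y) →ₗ[R] RightDual R T, IsShortExact (RightDual.map π) q := by
  have := finite_leftDual (R := R) Y
  let ev : Y → RightDual R (LeftDual R Y) := fun y =>
    { toFun := fun h => h y, map_add' := fun _ _ => rfl, map_smul' := fun _ _ => rfl }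
  let q : RightDual R (LeftDual R Y) →ₗ[R] RightDual R T :=
    RightDual.map ((LeftDual.map ρ).comp (evalRight R T))
  have hev : ∀ y, q (ev y) = ρ y := fun y => rfl
  -- Reflexivity of `Y^*` identifies the dual of `q` with the dual of `ρ`.
  have key : ∀ (h : LeftDual R (RightDual R T)) (y : RightDual R (LeftDual R Y)),
      h (q y) = y (LeftDual.map ρ h) := by
    intro h
    obtain ⟨g, hg⟩ := (isReflexive_of_projective (R := R) (LeftDual R Y)).2 (h ∘ₗ q)
    have hg' : ∀ y : RightDual R (LeftDual R Y), y g = h (q y) := LinearMap.congr_fun hg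
    have : g = LeftDual.map ρ h := by
      ext y
      exact (hg' (ev y)).trans (congrArg h (hev y))
    intro y
    rw [← this, hg']
  refine ⟨q, fun f g hfg => ?_, fun y => ⟨fun hy => ?_, ?_⟩, fun f => ?_⟩
  · ext x
    obtain ⟨z, rfl⟩ := hπ x
    exact LinearMap.congr_fun hfg z
  · obtain ⟨φ, hφ⟩ := exists_factor π hπ y (by
      intro z hz
      obtain ⟨h, rfl⟩ := (hex z).1 hz
      rw [LinearMap.mem_ker, ← key, hy, map_zero])
    exact ⟨φ, hφ⟩
  · rintro ⟨f, rfl⟩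
    ext t
    exact (congrArg f ((hex _).2 ⟨evalRight R T t, rfl⟩)).trans (map_zero f)
  · obtain ⟨y, rfl⟩ := hρ f
    exact ⟨ev y, hev y⟩

theorem extVanish_rightDual [IsNoetherianRing Rᵐᵒᵖ] (T : Type u) [AddCommGroup T]
    [Module Rᵐᵒᵖ T] [Module.Finite Rᵐᵒᵖ T] {k j : ℕ}
    (hR : HasInjectiveDimensionLT (ModuleCat.of R R) (k + 1)) (hj : k ≤ j + 2) :
    ExtVanish R (RightDual R T) R (j + 1) := by
  obtain ⟨P, p, hp, hker⟩ := exists_rightRes (R := R) T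
  have h1 : ExtVanish R (LinearMap.range (rowMap (P.d 0))) R (j + 2) :=
    (IsShortExact.subtype_mkQ (LinearMap.range (rowMap (P.d 0)))).extVanish_first
      (extVanish_of_projective _) (HasInjectiveDimensionLT.extVanish hR _ (by omega))
  have hs := IsShortExact.ker_rangeRestrict (rowMap (P.d 0))
  exact (hs.extVanish_first (extVanish_of_projective _) h1).of_equiv_left
    (rightDualEquiv (P.d 0) p hp hker).symm

/-- The dual of a module of `D`-class `m + 1` is an `(m + 2)`-nd syzygy. -/
theorem extVanish_rightDual_of_isDClass [IsNoetherianRing Rᵐᵒᵖ] {k : ℕ}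
    (hR : HasInjectiveDimensionLT (ModuleCat.of R R) (k + 1)) (m : ℕ) :
    ∀ (T : ModuleCat.{u} Rᵐᵒᵖ), Module.Finite Rᵐᵒᵖ T → IsDClass R (m + 1) T →
      ∀ j, k ≤ j + m + 2 → ExtVanish R (RightDual R T) R (j + 1) := by
  induction m with
  | zero => intro T _ _ j hj; exact extVanish_rightDual T hR hj
  | succ m ih =>
    intro N _ hN j hj
    rw [IsDClass] at hN
    obtain ⟨_, T, hT, hTD, Y, ρ, π, hY, hρ, hYp, hex, hπ⟩ := hN
    obtain ⟨q, hs⟩ := exists_isShortExact_rightDual ρ π hρ hex hπ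
    have := finite_leftDual (R := R) Y
    have := projective_rightDual (R := R) (LeftDual R Y)
    exact hs.extVanish_first (extVanish_of_projective _) (ih T hT hTD (j + 1) (by omega))

theorem isReflexive_of_isDClass [IsNoetherianRing Rᵐᵒᵖ] {k : ℕ}
    (hR : HasInjectiveDimensionLT (ModuleCat.of R R) (k + 1)) (N : ModuleCat.{u} Rᵐᵒᵖ)
    (hfin : Module.Finite Rᵐᵒᵖ N) (hN : IsDClass R k N) : IsReflexive R N := by
  match k, hN with
  | 0, _ => exact isReflexive_of_reducedGrade hR fun i hi => by omega
  | 1, hN =>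
    obtain ⟨P, p, hp, hker⟩ := exists_rightRes (R := R) N
    exact ⟨hN, P.evalRight_surjective hp hker (HasInjectiveDimensionLT.extVanish hR _ le_rfl)⟩
  | k + 2, hN =>
    rw [IsDClass] at hN
    obtain ⟨hN, T, hT, hTD, Y, ρ, π, hY, hρ, hYp, hex, hπ⟩ := hN
    obtain ⟨q, hs⟩ := exists_isShortExact_rightDual ρ π hρ hex hπ
    have := finite_leftDual (R := R) Y
    refine ⟨hN, fun g => ?_⟩
    obtain ⟨G, rfl⟩ := hs.extend_of_extVanish
      (extVanish_rightDual_of_isDClass hR k T hT hTD 0 (by omega)) g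
    obtain ⟨h, rfl⟩ := (isReflexive_of_projective (R := R) (LeftDual R Y)).2 G
    exact ⟨π h, rfl⟩

/-- The restriction of functionals from `R ^ (rank (n + 1))` to the image of the dual of `d_n`. -/
def LeftRes.restrictRow (P : LeftRes R) (n : ℕ) :
    (Fin (P.rank (n + 1)) → R) →ₗ[R] RightDual R (LinearMap.range (colMap (P.d n))) where
  toFun y := (ofRow y).comp (LinearMap.range (colMap (P.d n))).subtype
  map_add' y z := LinearMap.ext fun _ => add_dotProduct y z _
  map_smul' a y := LinearMap.ext fun _ => smul_dotProduct a y _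

variable (P : LeftRes R)

theorem LeftRes.restrictRow_surjective (n : ℕ) : Function.Surjective (P.restrictRow (n + 1)) := by
  intro f
  obtain ⟨y, hy⟩ := P.exists_row_of_comp_eq_zero (n := n)
    (f ∘ₗ (colMap (P.d (n + 1))).rangeRestrict) (fun v => by
      have : (colMap (P.d (n + 1))).rangeRestrict ((P.d n).mulVec v) = 0 := by
        ext1
        simp [Matrix.mulVec_mulVec, P.comp]
      rw [LinearMap.comp_apply, this, map_zero])
  refine ⟨y, LinearMap.ext fun x => ?_⟩
  obtain ⟨v, rfl⟩ := (colMap (P.d (n + 1))).surjective_rangeRestrict x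
  exact (hy v).symm

theorem LeftRes.ker_restrictRow (n : ℕ) :
    LinearMap.ker (P.restrictRow n) = LinearMap.ker (rowMap (P.d n)) := by
  ext y
  rw [LinearMap.mem_ker, LinearMap.mem_ker]
  constructor
  · intro h
    ext i
    have h1 := LinearMap.congr_fun h ((colMap (P.d n)).rangeRestrict (Pi.single i 1))
    have h2 : y ⬝ᵥ (P.d n).mulVec (Pi.single i 1) = 0 := h1
    rw [Matrix.dotProduct_mulVec, dotProduct_single_one] at h2
    exact h2
  · intro h
    ext x
    obtain ⟨v, rfl⟩ := (colMap (P.d n)).surjective_rangeRestrict x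
    have h1 : Matrix.vecMul y (P.d n) = 0 := h
    change y ⬝ᵥ (P.d n).mulVec v = 0
    rw [Matrix.dotProduct_mulVec, h1, zero_dotProduct]

/-- The dual of the image of `d_{n+1}^*` is the image of `d_{n+1}`. -/
noncomputable def LeftRes.rightDualRangeEquiv (n : ℕ) :
    RightDual R (LinearMap.range (colMap (P.d (n + 1)))) ≃ₗ[R]
      LinearMap.range (rowMap (P.d (n + 1))) :=
  ((P.restrictRow (n + 1)).quotKerEquivOfSurjective (P.restrictRow_surjective n)).symm.trans <|
    (Submodule.quotEquivOfEq _ _ (P.ker_restrictRow (n + 1))).trans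
      (rowMap (P.d (n + 1))).quotKerEquivRange

/-- The projection of the double dual embedding relating consecutive images of `d_n^*`. -/
def LeftRes.dualProj (n : ℕ) :
    LeftDual R (Fin (P.rank n) → R) →ₗ[Rᵐᵒᵖ] LinearMap.range (colMap (P.d n)) :=
  (colMap (P.d n)).rangeRestrict ∘ₗ (leftDualFreeEquiv R (P.rank n)).toLinearMap

theorem LeftRes.exact_dualProj (n : ℕ) :
    Function.Exact (LeftDual.map (P.restrictRow (n + 1))) (P.dualProj (n + 2)) := by
  intro h
  constructor
  · intro hh
    have h1 : (P.d (n + 2)).mulVec (fun i => h (Pi.single i 1)) = 0 := congrArg Subtype.val hh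
    obtain ⟨φ, hφ⟩ := exists_factor (P.restrictRow (n + 1)) (P.restrictRow_surjective n) h (by
      rw [P.ker_restrictRow, P.ker_eq_range]
      rintro _ ⟨y, rfl⟩
      rw [LinearMap.mem_ker, leftFunctional_apply, Matrix.vecMulLinear_apply,
        ← Matrix.dotProduct_mulVec, h1, dotProduct_zero])
    exact ⟨φ, hφ⟩
  · rintro ⟨φ, rfl⟩
    ext i
    change (P.d (n + 2)).mulVec _ i = 0
    rw [← single_one_dotProduct i ((P.d (n + 2)).mulVec _), Matrix.dotProduct_mulVec]
    refine (leftFunctional_apply (LeftDual.map (P.restrictRow (n + 1)) φ)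
      (Matrix.vecMul (Pi.single i 1) (P.d (n + 2)))).symm.trans ?_
    have h2 : Matrix.vecMul (Pi.single i 1) (P.d (n + 2)) ∈
        LinearMap.ker (P.restrictRow (n + 1)) := by
      rw [P.ker_restrictRow, P.ker_eq_range]
      exact ⟨_, rfl⟩
    change φ (P.restrictRow (n + 1) _) = 0
    rw [LinearMap.mem_ker.1 h2, map_zero]

theorem isTorsionless_submodule {n : ℕ} (W : Submodule Rᵐᵒᵖ (Fin n → R)) : IsTorsionless R W := by
  refine (injective_iff_map_eq_zero _).2 fun x hx => ?_
  ext i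
  exact LinearMap.congr_fun hx ((LinearMap.proj i : (Fin n → R) →ₗ[Rᵐᵒᵖ] R) ∘ₗ W.subtype)

/-- In the dual of a resolution, the image of the `(n + 1)`-st differential has `D`-class
`n + 1`. -/
theorem LeftRes.isDClass_range [IsNoetherianRing Rᵐᵒᵖ] (n : ℕ) :
    IsDClass R (n + 1) (ModuleCat.of Rᵐᵒᵖ (LinearMap.range (colMap (P.d (n + 1))))) := by
  induction n with
  | zero => exact isTorsionless_submodule _
  | succ n ih =>
    rw [IsDClass]
    refine ⟨isTorsionless_submodule _, _, inferInstanceAs (Module.Finite Rᵐᵒᵖ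
      (LinearMap.range (colMap (P.d (n + 1))))), ih,
      ModuleCat.of R (Fin (P.rank (n + 2)) → R), P.restrictRow (n + 1), P.dualProj (n + 2),
      inferInstanceAs (Module.Finite R (Fin (P.rank (n + 2)) → R)), P.restrictRow_surjective n,
      Module.Projective.of_equiv (leftDualFreeEquiv R (P.rank (n + 2))).symm,
      P.exact_dualProj n, (LinearMap.surjective_rangeRestrict _).comp (LinearEquiv.surjective _)⟩

/-- If the image of `d_{n+1}^*` is reflexive, the dual complex is exact in degree `n + 2`. -/
theorem LeftRes.exact_of_isReflexive (n : ℕ)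
    (h : IsReflexive R (LinearMap.range (colMap (P.d (n + 1))))) (v : Fin (P.rank (n + 2)) → R)
    (hv : (P.d (n + 2)).mulVec v = 0) : ∃ w, (P.d (n + 1)).mulVec w = v := by
  obtain ⟨φ, hφ⟩ := (P.exact_dualProj n ((leftDualFreeEquiv R _).symm v)).1 (by
    ext1
    change (P.d (n + 2)).mulVec ((leftDualFreeEquiv R _) ((leftDualFreeEquiv R _).symm v)) = 0
    rw [LinearEquiv.apply_symm_apply, hv])
  obtain ⟨⟨_, w, rfl⟩, rfl⟩ := h.2 φ
  refine ⟨w, ?_⟩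
  rw [LinearEquiv.eq_symm_apply] at hφ
  rw [← hφ]
  ext i
  exact (single_one_dotProduct i _).symm

end DClass

/-! ### Lowering the projective dimension -/

section LowerDimension

variable {R : Type u} [Ring R]

theorem IsShortExact.projective_third {X Y Z : Type u} [AddCommGroup X] [Module R X]
    [AddCommGroup Y] [Module R Y] [AddCommGroup Z] [Module R Z] {f : X →ₗ[R] Y} {g : Y →ₗ[R] Z}
    (h : IsShortExact f g) [Module.Finite R X] [Module.Projective R X] [Module.Projective R Y]
    (H : ∀ φ : X →ₗ[R] R, ∃ ψ : Y →ₗ[R] R, ψ ∘ₗ f = φ) : Module.Projective R Z := by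
  obtain ⟨n, p, hp⟩ := Module.Finite.exists_fin' R X
  obtain ⟨s, hs⟩ := Module.projective_lifting_property p LinearMap.id hp
  choose ψ hψ using fun i => H ((LinearMap.proj i : (Fin n → R) →ₗ[R] R) ∘ₗ s)
  let r : Y →ₗ[R] X := p ∘ₗ LinearMap.pi ψ
  have hr : ∀ x, r (f x) = x := by
    intro x
    have h1 : LinearMap.pi ψ (f x) = s x := by
      ext i
      exact LinearMap.congr_fun (hψ i) x
    exact (congrArg p h1).trans (LinearMap.congr_fun hs x)
  obtain ⟨σ, hσ⟩ := exists_factor g h.surj (LinearMap.id - f ∘ₗ r) (by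
    intro y hy
    obtain ⟨x, rfl⟩ := (h.exact y).1 hy
    simp [hr])
  refine Module.Projective.of_split σ g (LinearMap.ext fun z => ?_)
  obtain ⟨y, rfl⟩ := h.surj z
  have h2 : σ (g y) = y - f (r y) := LinearMap.congr_fun hσ y
  rw [LinearMap.comp_apply, h2, map_sub, (h.exact _).2 ⟨_, rfl⟩, sub_zero]
  rfl

theorem IsShortExact.hasProjectiveDimensionLT_third_iff {X Y Z : Type u} [AddCommGroup X]
    [Module R X] [AddCommGroup Y] [Module R Y] [AddCommGroup Z] [Module R Z] {f : X →ₗ[R] Y}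
    {g : Y →ₗ[R] Z} (h : IsShortExact f g) [Module.Projective R Y] (n : ℕ) :
    HasProjectiveDimensionLT (ModuleCat.of R Z) (n + 2) ↔
      HasProjectiveDimensionLT (ModuleCat.of R X) (n + 1) :=
  h.shortExact.hasProjectiveDimensionLT_X₃_iff n
    ((IsProjective.iff_projective (R := R) Y).1 inferInstance)

theorem LeftRes.isShortExact_range (P : LeftRes R) (n : ℕ) :
    IsShortExact (LinearMap.range (rowMap (P.d (n + 1)))).subtype
      (rowMap (P.d n)).rangeRestrict :=
  P.ker_eq_range n ▸ IsShortExact.ker_rangeRestrict (rowMap (P.d n))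

theorem LeftRes.hasProjectiveDimensionLT_iff (P : LeftRes R) {M : Type u} [AddCommGroup M]
    [Module R M] {p : (Fin (P.rank 0) → R) →ₗ[R] M} (hp : Function.Surjective p)
    (hker : LinearMap.ker p = LinearMap.range (rowMap (P.d 0))) (n j : ℕ) :
    HasProjectiveDimensionLT (ModuleCat.of R M) (j + n + 2) ↔
      HasProjectiveDimensionLT (ModuleCat.of R (LinearMap.range (rowMap (P.d n)))) (j + 1) := by
  induction n generalizing j with
  | zero =>
    have hs := IsShortExact.ker_subtype hp
    rw [hker] at hs
    exact hs.hasProjectiveDimensionLT_third_iff j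
  | succ n ih =>
    rw [← (P.isShortExact_range n).hasProjectiveDimensionLT_third_iff j, ← ih (j + 1)]
    rw [show j + (n + 1) + 2 = j + 1 + n + 2 by omega]

theorem hasProjectiveDimensionLT_of_step [IsNoetherianRing R] {k : ℕ}
    (H : ∀ M : ModuleCat.{u} R, Module.Finite R M → HasProjectiveDimensionLT M (k + 2) →
      HasProjectiveDimensionLT M (k + 1)) (m : ℕ) :
    ∀ M : ModuleCat.{u} R, Module.Finite R M → HasProjectiveDimensionLT M m →
      HasProjectiveDimensionLT M (k + 1) := by
  induction m with
  | zero => intro M _ h; exact hasProjectiveDimensionLT_of_ge M 0 _ (by omega)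
  | succ m ih =>
    intro M hM h
    by_cases hm : m + 1 ≤ k + 1
    · exact hasProjectiveDimensionLT_of_ge M (m + 1) _ hm
    obtain ⟨n, p, hp⟩ := Module.Finite.exists_fin' R M
    have hs := IsShortExact.ker_subtype hp
    obtain ⟨m, rfl⟩ : ∃ m', m = m' + 1 := ⟨m - 1, by omega⟩
    have h1 := (hs.hasProjectiveDimensionLT_third_iff m).1 h
    exact H M hM ((hs.hasProjectiveDimensionLT_third_iff k).2
      (ih _ (inferInstanceAs (Module.Finite R (LinearMap.ker p))) h1))

/-- Modules of projective dimension `k + 1` are excluded, for `k = n + 1`, if modules of `D`-class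
`k` with projective dual are projective. -/
theorem hasProjectiveDimensionLT_of_isDClass [IsNoetherianRing R] [IsNoetherianRing Rᵐᵒᵖ] {n : ℕ}
    (H : ∀ N : ModuleCat.{u} Rᵐᵒᵖ, Module.Finite Rᵐᵒᵖ N → IsDClass R (n + 1) N →
      Module.Projective R (RightDual R N) → Module.Projective Rᵐᵒᵖ N)
    (M : ModuleCat.{u} R) (hM : Module.Finite R M) (h : HasProjectiveDimensionLT M (n + 3)) :
    HasProjectiveDimensionLT M (n + 2) := by
  obtain ⟨P, p, hp, hker⟩ := exists_leftRes (R := R) M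
  have h1 : Module.Projective R (LinearMap.range (rowMap (P.d (n + 1)))) := by
    rw [← hasProjectiveDimensionLT_one_iff]
    refine (P.hasProjectiveDimensionLT_iff hp hker (n + 1) 0).1 ?_
    rw [show 0 + (n + 1) + 2 = n + 3 by omega]
    exact h
  have h2 : Module.Projective Rᵐᵒᵖ (LinearMap.range (colMap (P.d (n + 1)))) :=
    H (ModuleCat.of Rᵐᵒᵖ (LinearMap.range (colMap (P.d (n + 1)))))
      (inferInstanceAs (Module.Finite Rᵐᵒᵖ (LinearMap.range (colMap (P.d (n + 1))))))
      (P.isDClass_range n) (Module.Projective.of_equiv (P.rightDualRangeEquiv n).symm)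
  have h3 : Module.Projective R (LinearMap.range (rowMap (P.d n))) :=
    (P.isShortExact_range n).projective_third (P.extend_of_exact (n + 1)
      (P.exact_of_isReflexive n (isReflexive_of_projective _)))
  rw [← hasProjectiveDimensionLT_one_iff] at h3
  have h4 := (P.hasProjectiveDimensionLT_iff hp hker n 0).2 h3
  rw [show 0 + n + 2 = n + 2 by omega] at h4
  exact h4

end LowerDimension

end GorensteinModules

open GorensteinModules

theorem theorem2p16 (Λ : Type u) [Ring Λ] [IsNoetherianRing Λ] [IsNoetherianRing Λᵐᵒᵖ] (k : ℕ)
    (hΛ : GorensteinModules.IsKGorenstein Λ (k + 1)) :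
    (GorensteinModules.smallFinDim Λ = (k : WithBot ℕ∞) →
      injectiveDimension (ModuleCat.of Λ Λ) = (k : WithBot ℕ∞)) ∧
    List.TFAE [
      injectiveDimension (ModuleCat.of Λ Λ) ≤ (k : WithBot ℕ∞),
      GorensteinModules.bigFinDim Λ ≤ (k : WithBot ℕ∞),
      GorensteinModules.smallFinDim Λ ≤ (k : WithBot ℕ∞),
      ∀ N : ModuleCat.{u} Λᵐᵒᵖ, Module.Finite Λᵐᵒᵖ N →
        GorensteinModules.ReducedGradeGE Λ N (k + 1) → GorensteinModules.IsReflexive Λ N,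
      ∀ N : ModuleCat.{u} Λᵐᵒᵖ, Module.Finite Λᵐᵒᵖ N →
        GorensteinModules.ReducedGradeGE Λ N (k + 1) → GorensteinModules.IsTorsionless Λ N,
      ∀ N : ModuleCat.{u} Λᵐᵒᵖ, Module.Finite Λᵐᵒᵖ N →
        GorensteinModules.IsDClass Λ k N → GorensteinModules.IsReflexive Λ N,
      ∀ N : ModuleCat.{u} Λᵐᵒᵖ, Module.Finite Λᵐᵒᵖ N →
        GorensteinModules.IsDClass Λ k N → Module.Projective Λ (GorensteinModules.RightDual Λ N) →
        Module.Projective Λᵐᵒᵖ N] := by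
  have hid : injectiveDimension (ModuleCat.of Λ Λ) ≤ (k : WithBot ℕ∞) ↔
      HasInjectiveDimensionLT (ModuleCat.of Λ Λ) (k + 1) := injectiveDimension_le_iff _ _
  have hgrade := LeftRes.extVanish_cohomology hΛ k (Nat.lt_succ_self k)
  have h31 : smallFinDim Λ ≤ (k : WithBot ℕ∞) →
      injectiveDimension (ModuleCat.of Λ Λ) ≤ (k : WithBot ℕ∞) := fun h =>
    hid.2 (hasInjectiveDimensionLT_of_cohomology fun P =>
      subsingleton_of_grade ((smallFinDim_le_iff k).1 h) _ (hgrade P))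
  refine ⟨fun h => le_antisymm (h31 h.le) ?_, ?_⟩
  · by_contra hlt
    rw [not_le, injectiveDimension_lt_iff] at hlt
    exact (smallFinDim_lt_of_injectiveDimension_lt hlt).ne h
  tfae_have 1 → 2 := fun h => (bigFinDim_le_iff k).2
    (hasProjectiveDimensionLT_of_injectiveDimension (hid.1 h))
  tfae_have 2 → 3 := fun h => (smallFinDim_le_iff k).2 fun M _ => (bigFinDim_le_iff k).1 h M
  tfae_have 3 → 1 := h31
  tfae_have 1 → 4 := fun h N _ hN =>
    isReflexive_of_reducedGrade (hid.1 h) fun i hi => hN (i + 1) (by omega) (by omega)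
  tfae_have 4 → 5 := fun h N hfin hN => (h N hfin hN).1
  tfae_have 5 → 1 := fun h => hid.2 <| hasInjectiveDimensionLT_of_cohomology fun P =>
    subsingleton_of_isTorsionless
      (h (ModuleCat.of Λᵐᵒᵖ (P.cohomology k))
        (inferInstanceAs (Module.Finite Λᵐᵒᵖ (P.cohomology k)))
        fun j _ hj => hgrade P j (by omega))
      (extVanish_zero_iff.1 (hgrade P 0 (Nat.zero_le k)))
  tfae_have 1 → 6 := fun h => isReflexive_of_isDClass (hid.1 h)
  tfae_have 6 → 7 := fun h N hfin hN hp => by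
    have := finite_rightDual (R := Λ) N
    have := projective_leftDual (R := Λ) (RightDual Λ N)
    exact Module.Projective.of_equiv (LinearEquiv.ofBijective (evalRight Λ N) (h N hfin hN)).symm
  tfae_have 7 → 1 := fun h => by
    cases k with
    | zero =>
      refine hid.2 (hasInjectiveDimensionLT_of_cohomology fun P => ?_)
      have h0 := extVanish_zero_iff.1 (hgrade P 0 le_rfl)
      have : Subsingleton (RightDual Λ (P.cohomology 0)) := subsingleton_of_forall_eq 0 h0
      have := h (ModuleCat.of Λᵐᵒᵖ (P.cohomology 0))
        (inferInstanceAs (Module.Finite Λᵐᵒᵖ (P.cohomology 0))) trivial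
        (inferInstanceAs (Module.Projective Λ (RightDual Λ (P.cohomology 0))))
      exact subsingleton_of_isTorsionless
        (isReflexive_of_projective (P.cohomology 0)).1 h0
    | succ n =>
      exact h31 ((smallFinDim_le_iff (n + 1)).2 fun M hM m hm =>
        hasProjectiveDimensionLT_of_step (hasProjectiveDimensionLT_of_isDClass h) m M hM hm)
  tfae_finish
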